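/- Let $X$ be a real Banach space that is $(2,D)$-smooth, i.e. $D\ge 1$ and $\|x+y\|^2+\|x-y\|^2\le 2\|x\|^2+2D^2\|y\|^2$ for all $x,y\in X$. Let $(\mathcal F_j)_{j=0}^k$ be a finite filtration on a probability space $(\Omega,\mathcal F,\mathbb P)$ and write $\mathbb E_j$ for the conditional expectation given $\mathcal F_j$. Let $(f_j)_{j=0}^k$ be an adapted sequence of strongly measurable $X$-valued random variables, let $(g_j)_{j=0}^k$ be an $X$-valued martingale with differences $dg_j:=g_j-g_{j-1}$ $(1\le j\le k)$, and let $(V_j)_{j=1}^k$ be a strongly predictable sequence of random contractions on $X$: each $V_j$ maps $\Omega$ into the set of bounded linear operators on $X$ of norm at most $1$, and $\omega\mapsto V_j(\omega)x$ is strongly $\mathcal F_{j-1}$-measurable for every $x\in X$. Assume that almost surely $f_0=g_0=0$ and $$f_j=V_jf_{j-1}+dg_j,\qquad j=1,\dots,k.$$ Put $$f^\star:=\max_{0\le j\le k}\|f_j\|,\qquad dg^\star:=\max_{1\le j\le k}\|dg_j\|,\qquad s(g):=\Bigl(\sum_{j=1}^k\mathbb E_{j-1}\|dg_j\|^2\Bigr)^{1/2},$$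 where $dg^\star:=0$ if $k=0$, and where the conditional expectations are those of $[0,\infty]$-valued random variables. Let $\|\cdot\|_p$ denote the $L^p(\Omega)$-norm, with value $\infty$ allowed. Then for all $2\le p<\infty$, $$\|f^\star\|_p\le 30p\,\|dg^\star\|_p+40D\sqrt p\,\|s(g)\|_p .$$ If, moreover, $g$ has conditionally symmetric increments, i.e. $\mathbb E_{j-1}\mathbf 1_{\{dg_j\in B\}}=\mathbb E_{j-1}\mathbf 1_{\{-dg_j\in B\}}$ almost surely for all Borel sets $B\subseteq X$ and all $1\le j\le k$, then $$\|f^\star\|_p\le 5p\,\|dg^\star\|_p+10D\sqrt p\,\|s(g)\|_p .$$ -/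

import Mathlib

open MeasureTheory
open scoped ENNReal

namespace BurkholderRosenthal

/-- The normed space `X` is `(2, D)`-smooth. -/
def IsTwoSmooth (X : Type*) [NormedAddCommGroup X] (D : ℝ) : Prop :=
  1 ≤ D ∧ ∀ x y : X, ‖x + y‖ ^ 2 + ‖x - y‖ ^ 2 ≤ 2 * ‖x‖ ^ 2 + 2 * D ^ 2 * ‖y‖ ^ 2

variable {Ω X : Type*} [NormedAddCommGroup X]

/-- The difference sequence of `(g_j)_{j=0}^k`. The index `j : Fin k` stands for the increment
from time `j` to time `j + 1`, that is, `diffSeq g j = g_{j+1} - g_j`. -/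
def diffSeq {k : ℕ} (g : Fin (k + 1) → Ω → X) (j : Fin k) : Ω → X :=
  fun ω => g j.succ ω - g j.castSucc ω

/-- The maximal function `ω ↦ max_i ‖f_i(ω)‖` of a finite family (`0` for the empty family),
regarded as a function with values in `[0, ∞]`. -/
noncomputable def maximalFunction {ι : Type*} (f : ι → Ω → X) : Ω → ℝ≥0∞ :=
  fun ω => ⨆ i, ‖f i ω‖ₑ

/-- The conditional square function
`s(g) = (∑_{i=1}^k 𝔼[‖g_i - g_{i-1}‖² | ℱ_{i-1}])^{1/2}`. The conditional expectations are those of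
`[0, ∞]`-valued random variables, so that no square integrability is presupposed. -/
noncomputable def condSquareFunction {m0 : MeasurableSpace Ω} {k : ℕ}
    (ℱ : Filtration (Fin (k + 1)) m0) (μ : Measure Ω) (g : Fin (k + 1) → Ω → X) : Ω → ℝ≥0∞ :=
  fun ω => (∑ j : Fin k,
    condLExp (ℱ j.castSucc) μ (fun ω' => ‖diffSeq g j ω'‖ₑ ^ 2) ω) ^ (1 / 2 : ℝ)

/-- `ξ` and `η` are conditionally equi-distributed given the sub-σ-algebra `𝒢`:
`𝔼[1_{ξ ∈ B} | 𝒢] = 𝔼[1_{η ∈ B} | 𝒢]` almost surely, for all Borel sets `B ⊆ X`. -/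
def CondEquidistributed (𝒢 : MeasurableSpace Ω) {m0 : MeasurableSpace Ω} (μ : Measure Ω)
    (ξ η : Ω → X) : Prop :=
  ∀ B : Set X, MeasurableSet[borel X] B →
    μ[(ξ ⁻¹' B).indicator (fun _ => (1 : ℝ)) | 𝒢]
      =ᵐ[μ] μ[(η ⁻¹' B).indicator (fun _ => (1 : ℝ)) | 𝒢]

/-- The increments of `(g_j)_{j=0}^k` are conditionally symmetric: for `1 ≤ j ≤ k`, the random
variables `g_j - g_{j-1}` and `-(g_j - g_{j-1})` are conditionally equi-distributed given
`ℱ_{j-1}`. -/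
def HasCondSymmIncrements {m0 : MeasurableSpace Ω} {k : ℕ}
    (ℱ : Filtration (Fin (k + 1)) m0) (μ : Measure Ω) (g : Fin (k + 1) → Ω → X) : Prop :=
  ∀ j : Fin k, CondEquidistributed (ℱ j.castSucc) μ (diffSeq g j) (-diffSeq g j)

/-- `(V_j)_{j=1}^k` is a strongly predictable sequence of random contractions on `X`. The index
`j : Fin k` stands for time `j + 1`, so that `V j` is measurable at time `j`. -/
structure IsPredictableContraction [NormedSpace ℝ X] {m0 : MeasurableSpace Ω} {k : ℕ}
    (ℱ : Filtration (Fin (k + 1)) m0) (V : Fin k → Ω → X →L[ℝ] X) : Prop where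
  norm_le_one : ∀ j ω, ‖V j ω‖ ≤ 1
  stronglyMeasurable : ∀ j x, StronglyMeasurable[ℱ j.castSucc] (fun ω => V j ω x)

end BurkholderRosenthal

namespace BurkholderRosenthal

/-! The heart is a good-`λ` inequality, proved with an exponential supermartingale. Two-smoothness,
combined with the convexity of `cosh` in the square of its argument, gives a one-step bound
(`IsTwoSmooth.exists_cosh_truncate_le`): `cosh (l‖x + y‖)`, with `y` truncated at `a`, is at most
`cosh (l‖x‖) (1 + K‖y‖²)` plus a linear functional of the untruncated `y`. That functional has
conditional mean zero on a martingale difference, so truncation needs no recentring.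

Once `‖f‖` has exceeded `t`, run the recursion afresh from `0` with truncated jumps (`restart`). If
no jump exceeds `a`, this process stays within `t + a` of `f` until it is frozen, because the `V n`
are contractions; so `‖f‖ > t + a + r` forces it above `r`. Its `cosh`, divided by the product of
the factors `1 + K v i` with `v i` the conditional second moments, has integral at most the measure
of the exceedance event (`IsTwoSmooth.setLIntegral_restart_le`). Markov's inequality then bounds the
exceedance of `t + a + r`, on the event that jumps and conditional square function are small, by an
exponentially small multiple of the exceedance of `t`.

Integrating over `t` with `a` and the square function bound proportional to `t`, and absorbing the
`L^p` norm of the maximal function, gives the constants `5` and `10`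
(`IsTwoSmooth.eLpNorm_maximalFunction_le`), from which both claims follow. -/

open Filter Topology

/-! ### Two-smoothness of `cosh ‖·‖`. -/

section Smooth

/-- `cosh` lies below its chord as a function of the square of its argument. -/
theorem cosh_le_of_sq_le {a b c θ : ℝ} (h0 : 0 ≤ θ) (h1 : θ ≤ 1)
    (h : c ^ 2 = (1 - θ) * a ^ 2 + θ * b ^ 2) :
    Real.cosh c ≤ (1 - θ) * Real.cosh a + θ * Real.cosh b := by
  refine hasSum_le (fun n => ?_) (Real.hasSum_cosh c)
    (((Real.hasSum_cosh a).mul_left (1 - θ)).add ((Real.hasSum_cosh b).mul_left θ))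
  -- The `cosh` series has nonnegative coefficients in powers of the square, and each such power is
  -- convex.
  have key : (c ^ 2) ^ n ≤ (1 - θ) * (a ^ 2) ^ n + θ * (b ^ 2) ^ n := by
    rw [h]
    simpa using (convexOn_pow (𝕜 := ℝ) n).2 (sq_nonneg a) (sq_nonneg b)
      (sub_nonneg.2 h1) h0 (by ring)
  rw [pow_mul, pow_mul, pow_mul, mul_div_assoc', mul_div_assoc', ← add_div]
  gcongr

theorem sinh_le_mul_cosh {u : ℝ} (hu : 0 ≤ u) : Real.sinh u ≤ u * Real.cosh u := by
  refine hasSum_le (fun n => ?_) (Real.hasSum_sinh u) ((Real.hasSum_cosh u).mul_left u)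
  rw [pow_succ', mul_div_assoc]
  gcongr
  omega

/-- Half-angle formulas reduce this to `sinh_le_mul_cosh` at `v / 2`. -/
theorem cosh_sub_one_le {v : ℝ} (hv : 0 ≤ v) : Real.cosh v - 1 ≤ v * Real.sinh v / 2 := by
  have h2 : Real.cosh v = 1 + 2 * Real.sinh (v / 2) ^ 2 := by
    have := Real.cosh_two_mul (v / 2)
    rw [mul_div_cancel₀ v two_ne_zero] at this
    have := Real.cosh_sq (v / 2)
    linarith
  have h3 : Real.sinh v = 2 * Real.sinh (v / 2) * Real.cosh (v / 2) := by
    have := Real.sinh_two_mul (v / 2)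
    rwa [mul_div_cancel₀ v two_ne_zero] at this
  have h4 : 0 ≤ Real.sinh (v / 2) := Real.sinh_nonneg_iff.2 (by linarith)
  have h5 := mul_le_mul_of_nonneg_left (sinh_le_mul_cosh (u := v / 2) (by linarith)) h4
  rw [h2, h3]
  nlinarith

/-- Monotonicity of `sinh v / v`, seen term by term in the series. -/
theorem mul_sinh_le_mul_sinh {v η : ℝ} (hv : 0 ≤ v) (h : v ≤ η) :
    η * Real.sinh v ≤ v * Real.sinh η := by
  have hη : 0 ≤ η := hv.trans h
  refine hasSum_le (fun n => ?_) ((Real.hasSum_sinh v).mul_left η)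
    ((Real.hasSum_sinh η).mul_left v)
  rw [mul_div_assoc', mul_div_assoc']
  have : η * v ^ (2 * n + 1) ≤ v * η ^ (2 * n + 1) := by
    have h' : v ^ (2 * n) ≤ η ^ (2 * n) := pow_le_pow_left₀ hv h _
    calc η * v ^ (2 * n + 1) = η * v * v ^ (2 * n) := by ring
      _ ≤ η * v * η ^ (2 * n) := by gcongr
      _ = v * η ^ (2 * n + 1) := by ring
  gcongr

/-- `cosh` lies above its tangent at `u`. -/
theorem cosh_sub_mul_sinh_le (u w : ℝ) :
    Real.cosh u - w * Real.sinh u ≤ Real.cosh (u - w) := by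
  have h1 : Real.exp u * (1 - w) ≤ Real.exp (u - w) := by
    rw [sub_eq_add_neg u, Real.exp_add]
    gcongr
    linarith [Real.add_one_le_exp (-w)]
  have h2 : Real.exp (-u) * (1 + w) ≤ Real.exp (-(u - w)) := by
    rw [neg_sub, sub_eq_neg_add, Real.exp_add]
    gcongr
    linarith [Real.add_one_le_exp w]
  rw [Real.cosh_eq, Real.cosh_eq, Real.sinh_eq]
  linarith

/-- The chord bound with endpoints `u - v` and `u + v`. -/
theorem mul_cosh_le {u v a : ℝ} (hu : 0 < u) (hv : 0 < v) (h1 : (u - v) ^ 2 ≤ a ^ 2)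
    (h2 : a ^ 2 ≤ (u + v) ^ 2) :
    Real.cosh a ≤ Real.cosh u * Real.cosh v +
      (a ^ 2 - u ^ 2 - v ^ 2) / (2 * u * v) * (Real.sinh u * Real.sinh v) := by
  have huv : 0 < 4 * u * v := by positivity
  have h := cosh_le_of_sq_le (a := u - v) (b := u + v) (c := a)
    (θ := (a ^ 2 - (u - v) ^ 2) / (4 * u * v))
    (div_nonneg (by linarith) huv.le) ((div_le_one huv).2 (by linarith)) (by field_simp; ring)
  refine h.trans_eq ?_
  rw [Real.cosh_add, Real.cosh_sub]
  field_simp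
  ring

variable {X : Type*} [NormedAddCommGroup X]

/-- Apply the chord bound to `‖x + y‖` and `‖x - y‖` and add. Smoothness bounds the sum of the two
coefficients of `sinh u * sinh v` by `(D ^ 2 - 1) * v / u`, and `sinh u ≤ u * cosh u` removes the
division by `u`. -/
theorem IsTwoSmooth.cosh_add_cosh_le {D : ℝ} (hX : IsTwoSmooth X D) (x y : X) :
    Real.cosh ‖x + y‖ + Real.cosh ‖x - y‖ ≤
      2 * Real.cosh ‖x‖ * (1 + D ^ 2 * (‖y‖ * Real.sinh ‖y‖ / 2)) := by
  obtain ⟨hD, hX⟩ := hX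
  have hD2 : 1 ≤ D ^ 2 := one_le_pow₀ hD
  have hsy : 0 ≤ ‖y‖ * Real.sinh ‖y‖ :=
    mul_nonneg (norm_nonneg _) (Real.sinh_nonneg_iff.2 (norm_nonneg _))
  have hcy := cosh_sub_one_le (norm_nonneg y)
  rcases (norm_nonneg x).eq_or_lt with hx | hx
  · have : x = 0 := norm_eq_zero.1 hx.symm
    subst this
    simp only [zero_add, zero_sub, norm_neg, norm_zero, Real.cosh_zero]
    nlinarith
  rcases (norm_nonneg y).eq_or_lt with hy | hy
  · have : y = 0 := norm_eq_zero.1 hy.symm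
    subst this
    simp only [add_zero, sub_zero, norm_zero]
    nlinarith
  set u := ‖x‖
  set v := ‖y‖
  have low : ∀ z : X, |u - v| ≤ ‖z‖ → (u - v) ^ 2 ≤ ‖z‖ ^ 2 := fun z hz =>
    sq_le_sq' (by linarith [neg_abs_le (u - v)]) ((le_abs_self _).trans hz)
  have h1 := mul_cosh_le hx hy
    (low (x + y) (by simpa using abs_norm_sub_norm_le x (-y)))
    (pow_le_pow_left₀ (norm_nonneg _) (norm_add_le x y) 2)
  have h2 := mul_cosh_le hx hy (low (x - y) (abs_norm_sub_norm_le x y))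
    (pow_le_pow_left₀ (norm_nonneg _) (norm_sub_le x y) 2)
  have hs : 0 ≤ Real.sinh v := Real.sinh_nonneg_iff.2 hy.le
  have hsu := sinh_le_mul_cosh hx.le
  have h3 : (‖x + y‖ ^ 2 - u ^ 2 - v ^ 2) / (2 * u * v) + (‖x - y‖ ^ 2 - u ^ 2 - v ^ 2) / (2 * u * v)
      ≤ (D ^ 2 - 1) * v / u := by
    rw [← add_div, div_le_div_iff₀ (by positivity) hx]
    have := hX x y
    nlinarith [mul_le_mul_of_nonneg_right this hx.le]
  calc Real.cosh ‖x + y‖ + Real.cosh ‖x - y‖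
      ≤ 2 * (Real.cosh u * Real.cosh v) + ((‖x + y‖ ^ 2 - u ^ 2 - v ^ 2) / (2 * u * v)
          + (‖x - y‖ ^ 2 - u ^ 2 - v ^ 2) / (2 * u * v)) * (Real.sinh u * Real.sinh v) := by
        linarith
    _ ≤ 2 * (Real.cosh u * Real.cosh v) + (D ^ 2 - 1) * v / u * (Real.sinh u * Real.sinh v) := by
        have : 0 ≤ Real.sinh u * Real.sinh v :=
          mul_nonneg (Real.sinh_nonneg_iff.2 hx.le) hs
        gcongr
    _ ≤ 2 * (Real.cosh u * Real.cosh v)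
          + (D ^ 2 - 1) * v / u * (u * Real.cosh u * Real.sinh v) := by
        have : 0 ≤ D ^ 2 - 1 := by linarith
        gcongr
    _ = 2 * Real.cosh u * (Real.cosh v + (D ^ 2 - 1) * (v * Real.sinh v / 2)) := by
        field_simp
    _ ≤ _ := by
        have : 0 < Real.cosh u := Real.cosh_pos u
        exact mul_le_mul_of_nonneg_left (by linarith) (by linarith)

/-- The vector `y`, replaced by `0` if its norm exceeds `a`. -/
noncomputable def truncate (a : ℝ) (y : X) : X := if ‖y‖ ≤ a then y else 0

theorem norm_truncate_le {a : ℝ} (ha : 0 ≤ a) (y : X) : ‖truncate a y‖ ≤ a := by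
  unfold truncate
  split_ifs with h
  · exact h
  · simpa using ha

variable [NormedSpace ℝ X]

/-- A subgradient of `cosh ‖·‖` at `x`: `sinh ‖x‖` times a norming functional of `x`. -/
theorem exists_cosh_norm_sub_ge (x : X) :
    ∃ L : X →L[ℝ] ℝ, (∀ y, |L y| ≤ Real.sinh ‖x‖ * ‖y‖) ∧
      ∀ y, Real.cosh ‖x‖ - L y ≤ Real.cosh ‖x - y‖ := by
  obtain ⟨G, hG, hGx⟩ := exists_dual_vector'' ℝ x
  have hs : 0 ≤ Real.sinh ‖x‖ := Real.sinh_nonneg_iff.2 (norm_nonneg _)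
  have hGy : ∀ y, |G y| ≤ ‖y‖ := fun y => by
    simpa using G.le_of_opNorm_le hG y
  refine ⟨Real.sinh ‖x‖ • G, fun y => ?_, fun y => ?_⟩
  · simp only [smul_apply, smul_eq_mul, abs_mul, abs_of_nonneg hs]
    gcongr
    exact hGy y
  · have h1 := cosh_sub_mul_sinh_le ‖x‖ (G y)
    have h2 : Real.cosh (‖x‖ - G y) ≤ Real.cosh ‖x - y‖ := by
      rw [Real.cosh_le_cosh, abs_norm]
      have := hGy (x - y)
      rwa [map_sub, hGx] at this
    simp only [smul_apply, smul_eq_mul]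
    linarith

/-- The subgradient bound at `x - y` turns the symmetric two-point inequality into a one-sided one,
with the quadratic term doubled. -/
theorem IsTwoSmooth.exists_cosh_le {D : ℝ} (hX : IsTwoSmooth X D) (x : X) :
    ∃ L : X →L[ℝ] ℝ, (∀ y, |L y| ≤ Real.sinh ‖x‖ * ‖y‖) ∧
      ∀ y, Real.cosh ‖x + y‖ ≤
        Real.cosh ‖x‖ * (1 + D ^ 2 * (‖y‖ * Real.sinh ‖y‖)) + L y := by
  obtain ⟨L, hL, hL'⟩ := exists_cosh_norm_sub_ge x
  refine ⟨L, hL, fun y => ?_⟩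
  linarith [hX.cosh_add_cosh_le x y, hL' y]

/-- A one-step bound for truncated increments: the linear term acts on the full increment. -/
theorem IsTwoSmooth.exists_cosh_truncate_le {D : ℝ} (hX : IsTwoSmooth X D) {l a : ℝ}
    (hl : 0 < l) (ha : 0 < a) (hla : 1 ≤ Real.sinh (l * a)) (x : X) :
    ∃ L : X →L[ℝ] ℝ, ∀ y, Real.cosh (l * ‖x + truncate a y‖) ≤
      Real.cosh (l * ‖x‖) * (1 + D ^ 2 * (l * Real.sinh (l * a) / a) * ‖y‖ ^ 2) + L y := by
  have hn : ∀ z : X, ‖l • z‖ = l * ‖z‖ := fun z => by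
    rw [norm_smul, Real.norm_of_nonneg hl.le]
  have hD2 : 1 ≤ D ^ 2 := one_le_pow₀ hX.1
  obtain ⟨L, hL, hL'⟩ := hX.exists_cosh_le (l • x)
  refine ⟨l • L, fun y => ?_⟩
  have hc := Real.cosh_pos (l * ‖x‖)
  simp only [smul_apply, smul_eq_mul]
  by_cases hy : ‖y‖ ≤ a
  · have h := hL' (l • y)
    rw [← smul_add, hn, hn, hn, map_smul, smul_eq_mul] at h
    rw [truncate, if_pos hy]
    refine h.trans ?_
    have h1 := mul_sinh_le_mul_sinh (v := l * ‖y‖) (η := l * a) (by positivity) (by gcongr)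
    have h2 : l * ‖y‖ * Real.sinh (l * ‖y‖) ≤ l * Real.sinh (l * a) / a * ‖y‖ ^ 2 := by
      rw [div_mul_eq_mul_div, le_div_iff₀ ha]
      nlinarith [mul_le_mul_of_nonneg_left h1 (norm_nonneg y)]
    rw [mul_assoc (D ^ 2)]
    gcongr
  -- The truncated vector is `0`, so the quadratic term must outweigh `-L y`. It does, since `‖y‖ >
  -- a` and `sinh (l * a) ≥ 1`.
  · push Not at hy
    rw [truncate, if_neg (not_le.2 hy), add_zero]
    have h := hL y
    rw [hn] at h
    have h1 : l * |L y| ≤ Real.cosh (l * ‖x‖) * (l * ‖y‖) := by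
      have := Real.sinh_lt_cosh (l * ‖x‖)
      calc l * |L y| ≤ l * (Real.cosh (l * ‖x‖) * ‖y‖) := by
            gcongr
            exact h.trans (by gcongr)
        _ = _ := by ring
    have h2 : l * ‖y‖ ≤ D ^ 2 * (l * Real.sinh (l * a) / a) * ‖y‖ ^ 2 := by
      have : l * ‖y‖ * 1 ≤ l * Real.sinh (l * a) / a * ‖y‖ ^ 2 := by
        rw [div_mul_eq_mul_div, le_div_iff₀ ha]
        have : a * 1 ≤ ‖y‖ * Real.sinh (l * a) := by gcongr
        nlinarith [mul_le_mul_of_nonneg_left this (mul_nonneg hl.le (norm_nonneg y))]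
      rw [mul_one] at this
      refine this.trans ?_
      rw [mul_assoc]
      refine le_mul_of_one_le_left ?_ hD2
      positivity
    have h3 := mul_le_mul_of_nonneg_left h2 hc.le
    have h4 := mul_le_mul_of_nonneg_left (neg_abs_le (L y)) hl.le
    linarith

end Smooth

/-! ### The one-step inequality under conditional expectation. -/

section OneStep

variable {X : Type*} [NormedAddCommGroup X]

/-- The function `y ↦ cosh (l ‖y‖)` with values in `[0, ∞]`. -/
noncomputable def coshNorm (l : ℝ) (y : X) : ℝ≥0∞ := ENNReal.ofReal (Real.cosh (l * ‖y‖))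

theorem continuous_coshNorm (l : ℝ) : Continuous (coshNorm l : X → ℝ≥0∞) :=
  ENNReal.continuous_ofReal.comp
    (Real.continuous_cosh.comp (continuous_const.mul continuous_norm))

theorem coshNorm_mono {l : ℝ} (hl : 0 ≤ l) {x y : X} (h : ‖x‖ ≤ ‖y‖) :
    coshNorm l x ≤ coshNorm l y := by
  refine ENNReal.ofReal_le_ofReal ?_
  rw [Real.cosh_le_cosh, abs_of_nonneg (by positivity), abs_of_nonneg (by positivity)]
  gcongr

variable {Ω : Type*} {m m0 : MeasurableSpace Ω} {μ : Measure Ω}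

theorem stronglyMeasurable_truncate {d : Ω → X} (hd : StronglyMeasurable[m] d) (a : ℝ) :
    StronglyMeasurable[m] (fun ω => truncate a (d ω)) := by
  unfold truncate
  exact StronglyMeasurable.ite (measurableSet_le hd.norm.measurable measurable_const) hd
    stronglyMeasurable_const

/-- An inequality between integrals over all sets of a sub-σ-algebra carries over to weights
measurable with respect to it. -/
theorem lintegral_mul_le_of_setLIntegral_le (hm : m ≤ m0) {φ ψ W : Ω → ℝ≥0∞}
    (hφ : Measurable[m0] φ) (hψ : Measurable[m0] ψ)
    (h : ∀ G, MeasurableSet[m] G → ∫⁻ ω in G, φ ω ∂μ ≤ ∫⁻ ω in G, ψ ω ∂μ)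
    (hW : Measurable[m] W) :
    ∫⁻ ω, W ω * φ ω ∂μ ≤ ∫⁻ ω, W ω * ψ ω ∂μ := by
  -- The hypothesis orders the measures with densities `φ` and `ψ` once both are trimmed to `m`; `W`
  -- is then integrated against them.
  have key : ∀ {χ : Ω → ℝ≥0∞}, Measurable[m0] χ →
      ∫⁻ ω, W ω ∂((μ.withDensity χ).trim hm) = ∫⁻ ω, W ω * χ ω ∂μ := fun {χ} hχ => by
    rw [lintegral_trim hm hW, lintegral_withDensity_eq_lintegral_mul _ hχ (hW.mono hm le_rfl)]
    simp [mul_comm]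
  rw [← key hφ, ← key hψ]
  refine lintegral_mono' (Measure.le_iff.2 fun G hG => ?_) le_rfl
  rw [trim_measurableSet_eq hm hG, trim_measurableSet_eq hm hG, withDensity_apply _ (hm G hG),
    withDensity_apply _ (hm G hG)]
  exact h G hG

/-- Substitution of a simple function for a constant in an inequality between integrals. -/
theorem setLIntegral_simpleFunc_le {E : Type*} (hm : m ≤ m0) {φ ψ : E → Ω → ℝ≥0∞}
    (h : ∀ c H, MeasurableSet[m] H → ∫⁻ ω in H, φ c ω ∂μ ≤ ∫⁻ ω in H, ψ c ω ∂μ)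
    (y : @SimpleFunc Ω m E) {G : Set Ω} (hG : MeasurableSet[m] G) :
    ∫⁻ ω in G, φ (y ω) ω ∂μ ≤ ∫⁻ ω in G, ψ (y ω) ω ∂μ := by
  obtain ⟨s, hs⟩ : ∃ s : Finset E, ∀ ω, y ω ∈ s :=
    ⟨@SimpleFunc.range _ _ m y, fun ω => @SimpleFunc.mem_range_self _ _ m y ω⟩
  have hGU : G = ⋃ c ∈ s, (G ∩ y ⁻¹' {c}) := by
    ext ω
    simp [hs]
  have hfib : ∀ c, MeasurableSet[m] (G ∩ y ⁻¹' {c}) := fun c =>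
    hG.inter (@SimpleFunc.measurableSet_fiber _ _ m y c)
  have hdisj : Set.PairwiseDisjoint (s : Set E) (fun c => G ∩ y ⁻¹' {c}) := by
    intro c _ c' _ hcc
    exact Set.disjoint_left.2 fun ω h h' => hcc (h.2.symm.trans h'.2)
  rw [hGU, lintegral_biUnion_finset hdisj fun c _ => hm _ (hfib c),
    lintegral_biUnion_finset hdisj fun c _ => hm _ (hfib c)]
  refine Finset.sum_le_sum fun c _ => ?_
  have sub : ∀ χ : E → Ω → ℝ≥0∞, ∫⁻ ω in G ∩ y ⁻¹' {c}, χ (y ω) ω ∂μ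
      = ∫⁻ ω in G ∩ y ⁻¹' {c}, χ c ω ∂μ := fun χ =>
    setLIntegral_congr_fun (hm _ (hfib c)) fun ω hω => by
      have : y ω = c := hω.2
      simp only [this]
  rw [sub φ, sub ψ]
  exact h c _ (hfib c)

variable [NormedSpace ℝ X] [CompleteSpace X]

/-- The linear term acts on `d` itself, hence integrates to zero over `G` although the increment
inside `cosh` is truncated. -/
theorem IsTwoSmooth.setLIntegral_coshNorm_const_add_truncate_le [IsFiniteMeasure μ] {D : ℝ}
    (hX : IsTwoSmooth X D) {l a : ℝ} (hl : 0 < l) (ha : 0 < a) (hla : 1 ≤ Real.sinh (l * a))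
    {d : Ω → X} (hd : MemLp d 2 μ) {G : Set Ω} (hd0 : ∫ ω in G, d ω ∂μ = 0) (x : X) :
    ∫⁻ ω in G, coshNorm l (x + truncate a (d ω)) ∂μ ≤
      ∫⁻ ω in G, coshNorm l x *
        (1 + ENNReal.ofReal (D ^ 2 * (l * Real.sinh (l * a) / a)) * ‖d ω‖ₑ ^ 2) ∂μ := by
  obtain ⟨L, hL⟩ := hX.exists_cosh_truncate_le hl ha hla x
  set K := D ^ 2 * (l * Real.sinh (l * a) / a) with hK
  have hK0 : 0 ≤ K := by positivity
  have hc := (Real.cosh_pos (l * ‖x‖)).le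
  have hd1 : Integrable d (μ.restrict G) := (hd.integrable one_le_two).integrableOn
  have hd2 : Integrable (fun ω => ‖d ω‖ ^ 2) (μ.restrict G) := (hd.integrable_norm_pow two_ne_zero).integrableOn
  have hi : Integrable (fun ω => Real.cosh (l * ‖x‖) * (1 + K * ‖d ω‖ ^ 2)) (μ.restrict G) :=
    ((integrable_const 1).add (hd2.const_mul K)).const_mul _
  have hLi : Integrable (fun ω => L (d ω)) (μ.restrict G) := L.integrable_comp hd1
  have hL0 : ∫ ω in G, L (d ω) ∂μ = 0 := by
    rw [L.integral_comp_comm hd1, hd0, map_zero]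
  calc ∫⁻ ω in G, coshNorm l (x + truncate a (d ω)) ∂μ
      ≤ ∫⁻ ω in G, ENNReal.ofReal
          (Real.cosh (l * ‖x‖) * (1 + K * ‖d ω‖ ^ 2) + L (d ω)) ∂μ :=
        lintegral_mono fun ω => ENNReal.ofReal_le_ofReal (hL (d ω))
    _ = ENNReal.ofReal (∫ ω in G,
          (Real.cosh (l * ‖x‖) * (1 + K * ‖d ω‖ ^ 2) + L (d ω)) ∂μ) :=
        (ofReal_integral_eq_lintegral_ofReal (hi.add hLi)
          (Eventually.of_forall fun ω => (Real.cosh_pos _).le.trans (hL (d ω)))).symm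
    _ = ENNReal.ofReal (∫ ω in G, Real.cosh (l * ‖x‖) * (1 + K * ‖d ω‖ ^ 2) ∂μ) := by
        rw [integral_add hi hLi, hL0, add_zero]
    _ = ∫⁻ ω in G, ENNReal.ofReal (Real.cosh (l * ‖x‖) * (1 + K * ‖d ω‖ ^ 2)) ∂μ :=
        ofReal_integral_eq_lintegral_ofReal hi (Eventually.of_forall fun ω => by positivity)
    _ = _ := by
        refine lintegral_congr fun ω => ?_
        rw [ENNReal.ofReal_mul hc, ENNReal.ofReal_add zero_le_one (by positivity),
          ENNReal.ofReal_mul hK0, ENNReal.ofReal_pow (norm_nonneg _), ofReal_norm,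
          ENNReal.ofReal_one, coshNorm]

/-- The one-step bound: `x` is known at time `m`, the increment `d` is centred given `m`, and `v` is
its conditional second moment. -/
theorem IsTwoSmooth.lintegral_mul_coshNorm_add_truncate_le [IsFiniteMeasure μ] {D : ℝ}
    (hX : IsTwoSmooth X D) (hm : m ≤ m0) {l a : ℝ} (hl : 0 < l) (ha : 0 < a)
    (hla : 1 ≤ Real.sinh (l * a)) {d : Ω → X} (hdm : StronglyMeasurable[m0] d) (hd : MemLp d 2 μ)
    (hd0 : ∀ G, MeasurableSet[m] G → ∫ ω in G, d ω ∂μ = 0)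
    {v : Ω → ℝ≥0∞} (hv : Measurable[m] v)
    (hvd : ∀ G, MeasurableSet[m] G → ∫⁻ ω in G, v ω ∂μ = ∫⁻ ω in G, ‖d ω‖ₑ ^ 2 ∂μ)
    {x : Ω → X} (hx : StronglyMeasurable[m] x) {R : ℝ} (hR : ∀ ω, ‖x ω‖ ≤ R)
    {W : Ω → ℝ≥0∞} (hW : Measurable[m] W) :
    ∫⁻ ω, W ω * coshNorm l (x ω + truncate a (d ω)) ∂μ ≤
      ∫⁻ ω, W ω * (coshNorm l (x ω) *
        (1 + ENNReal.ofReal (D ^ 2 * (l * Real.sinh (l * a) / a)) * v ω)) ∂μ := by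
  set K := ENNReal.ofReal (D ^ 2 * (l * Real.sinh (l * a) / a)) with hK
  have hv' : Measurable[m0] v := hv.mono hm le_rfl
  have hdt := stronglyMeasurable_truncate hdm a
  have meas1 : ∀ {y : Ω → X}, StronglyMeasurable[m] y →
      Measurable[m0] (fun ω => coshNorm l (y ω + truncate a (d ω))) := fun {y} hy =>
    ((continuous_coshNorm l).comp_stronglyMeasurable ((hy.mono hm).add hdt)).measurable
  have meas2 : ∀ {y : Ω → X}, StronglyMeasurable[m] y →
      Measurable[m0] (fun ω => coshNorm l (y ω) * (1 + K * v ω)) := fun {y} hy =>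
    ((continuous_coshNorm l).comp_stronglyMeasurable (hy.mono hm)).measurable.mul
      ((hv'.const_mul K).const_add 1)
  refine lintegral_mul_le_of_setLIntegral_le hm (meas1 hx) (meas2 hx) (fun G hG => ?_) hW
  have const : ∀ (c : X) (H : Set Ω), MeasurableSet[m] H →
      ∫⁻ ω in H, coshNorm l (c + truncate a (d ω)) ∂μ ≤
        ∫⁻ ω in H, coshNorm l c * (1 + K * v ω) ∂μ := fun c H hH => by
    refine (hX.setLIntegral_coshNorm_const_add_truncate_le hl ha hla hd (hd0 H hH) c).trans_eq ?_
    have hdn : Measurable[m0] (fun ω => ‖d ω‖ₑ ^ 2) := hdm.enorm.pow_const 2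
    rw [lintegral_const_mul _ ((hdn.const_mul _).const_add _),
      lintegral_const_mul _ ((hv'.const_mul _).const_add _), lintegral_add_left measurable_const,
      lintegral_add_left measurable_const, lintegral_const_mul _ hdn, lintegral_const_mul _ hv',
      hvd H hH]
  have simple : ∀ y : @SimpleFunc Ω m X,
      ∫⁻ ω in G, coshNorm l (y ω + truncate a (d ω)) ∂μ ≤
        ∫⁻ ω in G, coshNorm l (y ω) * (1 + K * v ω) ∂μ := fun y =>
    setLIntegral_simpleFunc_le hm (φ := fun c ω => coshNorm l (c + truncate a (d ω)))
      (ψ := fun c ω => coshNorm l c * (1 + K * v ω)) const y hG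
  have hvfin : ∫⁻ ω, v ω ∂μ ≠ ∞ := by
    have h := hvd Set.univ MeasurableSet.univ
    rw [Measure.restrict_univ] at h
    rw [h]
    have := (hd.integrable_norm_pow two_ne_zero).hasFiniteIntegral
    simpa [HasFiniteIntegral] using this.ne
  by_cases hRn : 0 ≤ R
  swap
  · have : IsEmpty Ω := ⟨fun ω => hRn ((norm_nonneg _).trans (hR ω))⟩
    simp [lintegral_of_isEmpty]
  have hlim : ∀ ω, Tendsto (fun n => hx.approxBounded R n ω) atTop (𝓝 (x ω)) := fun ω =>
    hx.tendsto_approxBounded_of_norm_le (hR ω)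
  have happ : ∀ n, StronglyMeasurable[m] (hx.approxBounded R n) := fun n =>
    (hx.approxBounded R n).stronglyMeasurable
  have hfin : ∀ᵐ ω ∂(μ.restrict G), v ω ≠ ∞ :=
    ae_restrict_of_ae ((ae_lt_top hv' hvfin).mono fun ω h => h.ne)
  have hbound : ∀ n ω, coshNorm l (hx.approxBounded R n ω) ≤ ENNReal.ofReal (Real.cosh (l * R)) := by
    intro n ω
    refine ENNReal.ofReal_le_ofReal ?_
    rw [Real.cosh_le_cosh, abs_of_nonneg (by positivity), abs_of_nonneg (by positivity)]
    gcongr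
    exact hx.norm_approxBounded_le hRn n ω
  have hfin2 : ∫⁻ ω in G, ENNReal.ofReal (Real.cosh (l * R)) * (1 + K * v ω) ∂μ ≠ ∞ := by
    rw [lintegral_const_mul _ ((hv'.const_mul _).const_add _), lintegral_add_left measurable_const,
      lintegral_const_mul _ hv']
    have : ∫⁻ ω in G, v ω ∂μ ≠ ∞ := ((setLIntegral_le_lintegral G v).trans_lt hvfin.lt_top).ne
    exact ENNReal.mul_ne_top ENNReal.ofReal_ne_top
      (ENNReal.add_ne_top.2 ⟨by simp, ENNReal.mul_ne_top ENNReal.ofReal_ne_top this⟩)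
  -- From simple functions to `x`: Fatou on the left, dominated convergence on the right, where
  -- boundedness of `x` and integrability of `v` supply the majorant.
  calc ∫⁻ ω in G, coshNorm l (x ω + truncate a (d ω)) ∂μ
      = ∫⁻ ω in G, liminf (fun n => coshNorm l (hx.approxBounded R n ω + truncate a (d ω))) atTop
          ∂μ := by
        refine lintegral_congr fun ω => (Tendsto.liminf_eq ?_).symm
        exact ((continuous_coshNorm l).tendsto _).comp ((hlim ω).add_const _)
    _ ≤ liminf (fun n => ∫⁻ ω in G, coshNorm l (hx.approxBounded R n ω + truncate a (d ω)) ∂μ)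
          atTop := lintegral_liminf_le fun n => meas1 (happ n)
    _ ≤ liminf (fun n => ∫⁻ ω in G, coshNorm l (hx.approxBounded R n ω) * (1 + K * v ω) ∂μ)
          atTop := liminf_le_liminf (Eventually.of_forall fun n => simple _)
    _ = ∫⁻ ω in G, coshNorm l (x ω) * (1 + K * v ω) ∂μ := by
        refine Tendsto.liminf_eq ?_
        refine tendsto_lintegral_of_dominated_convergence
          (fun ω => ENNReal.ofReal (Real.cosh (l * R)) * (1 + K * v ω)) (fun n => meas2 (happ n))
          (fun n => Eventually.of_forall fun ω => ?_) hfin2 ?_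
        · dsimp only
          gcongr
          exact hbound n ω
        · filter_upwards [hfin] with ω hω
          refine ((ENNReal.continuous_mul_const (by finiteness)).tendsto _).comp ?_
          exact ((continuous_coshNorm l).tendsto _).comp (hlim ω)

end OneStep

/-! ### The restarted process and its comparison with `f`. -/

section Processes

variable {Ω X : Type*} [NormedAddCommGroup X]

/-- The set where one of `f 0, …, f n` exceeds `t` in norm. -/
def exceedSet (f : ℕ → Ω → X) (t : ℝ) (n : ℕ) : Set Ω := {ω | ∃ i ≤ n, t < ‖f i ω‖}

theorem exceedSet_mono (f : ℕ → Ω → X) (t : ℝ) : Monotone (exceedSet f t) :=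
  fun _ _ hmn _ ⟨i, hi, h⟩ => ⟨i, hi.trans hmn, h⟩

theorem measurableSet_exceedSet {m0 : MeasurableSpace Ω} {ℱ : Filtration ℕ m0} {f : ℕ → Ω → X}
    (hf : ∀ n, StronglyMeasurable[ℱ n] (f n)) (t : ℝ) (n : ℕ) :
    MeasurableSet[ℱ n] (exceedSet f t n) := by
  have : exceedSet f t n = ⋃ i ∈ Set.Iic n, {ω | t < ‖f i ω‖} := by
    ext ω
    simp [exceedSet]
  rw [this]
  exact MeasurableSet.biUnion (Set.to_countable _) fun i hi => measurableSet_lt measurable_const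
    ((hf i).mono (ℱ.mono hi)).norm.measurable

variable [NormedSpace ℝ X]

/-- `V` is only strongly measurable pointwise, so `h` is approximated by simple functions;
continuity of each `V ω` gives the limit. -/
theorem stronglyMeasurable_clm_apply {m : MeasurableSpace Ω} {V : Ω → X →L[ℝ] X} {h : Ω → X}
    (hV : ∀ x, StronglyMeasurable[m] (fun ω => V ω x)) (hh : StronglyMeasurable[m] h) :
    StronglyMeasurable[m] (fun ω => V ω (h ω)) := by
  refine stronglyMeasurable_of_tendsto atTop (f := fun n ω => V ω (hh.approx n ω)) (fun n => ?_)
    (tendsto_pi_nhds.2 fun ω => ((V ω).continuous.tendsto _).comp (hh.tendsto_approx ω))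
  have : (fun ω => V ω (hh.approx n ω)) = fun ω => ∑ c ∈ (hh.approx n).range,
      (hh.approx n ⁻¹' {c}).indicator (fun ω => V ω c) ω := by
    ext ω
    rw [Finset.sum_eq_single (hh.approx n ω)]
    · simp
    · intro c _ hc
      simp [hc.symm]
    · intro hc
      exact absurd (SimpleFunc.mem_range_self _ ω) hc
  rw [this]
  exact Finset.stronglyMeasurable_fun_sum _ fun c _ =>
    (hV c).indicator ((hh.approx n).measurableSet_fiber c)

open Classical in
/-- The process with jumps truncated at `a` that starts from `0` once `f` has exceeded the level `t`
and is frozen once it exceeds `r` itself. -/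
noncomputable def restart (V : ℕ → Ω → X →L[ℝ] X) (f d : ℕ → Ω → X) (t a r : ℝ) : ℕ → Ω → X
  | 0 => fun _ => 0
  | n + 1 => fun ω =>
    if ω ∈ exceedSet f t n ∧ ‖restart V f d t a r n ω‖ ≤ r then
      V n ω (restart V f d t a r n ω) + truncate a (d n ω)
    else restart V f d t a r n ω

variable {V : ℕ → Ω → X →L[ℝ] X} {f d : ℕ → Ω → X} {t a r : ℝ}

theorem restart_succ_of_mem {n : ℕ} {ω : Ω} (h : ω ∈ exceedSet f t n)
    (h' : ‖restart V f d t a r n ω‖ ≤ r) : restart V f d t a r (n + 1) ω =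
      V n ω (restart V f d t a r n ω) + truncate a (d n ω) := by
  rw [restart]
  exact if_pos ⟨h, h'⟩

theorem restart_succ_of_not {n : ℕ} {ω : Ω}
    (h : ¬ (ω ∈ exceedSet f t n ∧ ‖restart V f d t a r n ω‖ ≤ r)) :
    restart V f d t a r (n + 1) ω = restart V f d t a r n ω := by
  rw [restart]
  exact if_neg h

/-- Thus the process is still `0` at the very time when `f` first exceeds `t`; it can move only at
the following step. -/
theorem restart_succ_eq_zero {n : ℕ} {ω : Ω} (h : ω ∉ exceedSet f t n) :
    restart V f d t a r (n + 1) ω = 0 := by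
  induction n with
  | zero => rw [restart_succ_of_not fun h' => h h'.1, restart]
  | succ n ih =>
    rw [restart_succ_of_not fun h' => h h'.1]
    exact ih fun h' => h (exceedSet_mono f t n.le_succ h')

/-- A step is taken only from norm at most `r`, so the overshoot is at most one truncated jump. -/
theorem norm_restart_le (ha : 0 ≤ a) (hr : 0 ≤ r) (hV : ∀ n ω, ‖V n ω‖ ≤ 1) (n : ℕ) (ω : Ω) :
    ‖restart V f d t a r n ω‖ ≤ r + a := by
  induction n with
  | zero => simpa [restart] using add_nonneg hr ha
  | succ n ih =>
    by_cases h : ω ∈ exceedSet f t n ∧ ‖restart V f d t a r n ω‖ ≤ r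
    · rw [restart_succ_of_mem h.1 h.2]
      refine (norm_add_le _ _).trans (add_le_add ?_ (norm_truncate_le ha _))
      exact ((V n ω).le_of_opNorm_le (hV n ω) _).trans (by simpa using h.2)
    · rwa [restart_succ_of_not h]

theorem lt_norm_restart_mono {n p : ℕ} {ω : Ω} (hnp : n ≤ p)
    (h : r < ‖restart V f d t a r n ω‖) : r < ‖restart V f d t a r p ω‖ := by
  induction p, hnp using Nat.le_induction with
  | base => exact h
  | succ p _ ih => rwa [restart_succ_of_not fun h' => ih.not_ge h'.2]

/-- Through the first exceedance time the process is `0` and `‖f‖` is at most `t` plus one jump.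
Afterwards, until freezing, both processes receive the same jump, and their difference is only moved
by the contraction. -/
theorem lt_norm_restart_or_norm_sub_le {N : ℕ} {ω : Ω} (ht : 0 ≤ t) (ha : 0 ≤ a)
    (hV : ∀ n, ‖V n ω‖ ≤ 1) (h0 : f 0 ω = 0)
    (hrec : ∀ n, f (n + 1) ω = V n ω (f n ω) + d n ω) (hd : ∀ n < N, ‖d n ω‖ ≤ a) :
    ∀ n ≤ N, r < ‖restart V f d t a r n ω‖ ∨ ‖f n ω - restart V f d t a r n ω‖ ≤ t + a := by
  intro n
  induction n with
  | zero =>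
    intro _
    right
    simpa [restart, h0] using add_nonneg ht ha
  | succ n ih =>
    intro hn
    have hdn := hd n hn
    by_cases hm : ω ∈ exceedSet f t n
    · by_cases hr : ‖restart V f d t a r n ω‖ ≤ r
      · right
        have hle := (ih (Nat.le_of_succ_le hn)).resolve_left (not_lt.2 hr)
        rw [restart_succ_of_mem hm hr, hrec, truncate, if_pos hdn, add_sub_add_right_eq_sub,
          ← map_sub]
        exact ((V n ω).le_of_opNorm_le (hV n) _).trans (by simpa using hle)
      · left
        exact lt_norm_restart_mono n.le_succ (not_le.1 hr)
    · right
      rw [restart_succ_eq_zero hm, sub_zero, hrec]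
      have hfn : ‖f n ω‖ ≤ t := not_lt.1 fun h => hm ⟨n, le_rfl, h⟩
      refine (norm_add_le _ _).trans (add_le_add ?_ hdn)
      exact ((V n ω).le_of_opNorm_le (hV n) _).trans (by simpa using hfn)

theorem lt_norm_restart {N : ℕ} {ω : Ω} (ht : 0 ≤ t) (ha : 0 ≤ a)
    (hV : ∀ n, ‖V n ω‖ ≤ 1) (h0 : f 0 ω = 0)
    (hrec : ∀ n, f (n + 1) ω = V n ω (f n ω) + d n ω) (hd : ∀ n < N, ‖d n ω‖ ≤ a)
    (h : ω ∈ exceedSet f (t + a + r) N) : r < ‖restart V f d t a r N ω‖ := by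
  obtain ⟨n, hn, hfn⟩ := h
  refine lt_norm_restart_mono hn ?_
  refine (lt_norm_restart_or_norm_sub_le ht ha hV h0 hrec hd n hn).elim id fun h => ?_
  linarith [norm_sub_norm_le (f n ω) (restart V f d t a r n ω)]

theorem stronglyMeasurable_restart {m0 : MeasurableSpace Ω} {ℱ : Filtration ℕ m0}
    (hVm : ∀ n x, StronglyMeasurable[ℱ n] (fun ω => V n ω x))
    (hf : ∀ n, StronglyMeasurable[ℱ n] (f n)) (hd : ∀ n, StronglyMeasurable[ℱ (n + 1)] (d n))
    (n : ℕ) : StronglyMeasurable[ℱ n] (restart V f d t a r n) := by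
  induction n with
  | zero => exact stronglyMeasurable_const
  | succ n ih =>
    have hle := ℱ.mono n.le_succ
    unfold restart
    exact StronglyMeasurable.ite
      (hle _ ((measurableSet_exceedSet hf t n).inter
        (measurableSet_le ih.norm.measurable measurable_const)))
      (((stronglyMeasurable_clm_apply (hVm n) ih).mono hle).add
        (stronglyMeasurable_truncate (hd n) a)) (ih.mono hle)

end Processes

/-- From `1 + x ≤ exp x`: a bound on the conditional variance makes the compensating product
deterministically large. -/
theorem exp_neg_le_prod_inv {ι : Type*} (s : Finset ι) {v : ι → ℝ≥0∞} {K c : ℝ} (hK : 0 ≤ K)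
    (hc : 0 ≤ c) (h : ∑ i ∈ s, v i ≤ ENNReal.ofReal c) :
    ENNReal.ofReal (Real.exp (-(K * c))) ≤ ∏ i ∈ s, (1 + ENNReal.ofReal K * v i)⁻¹ := by
  have hv : ∀ i ∈ s, v i ≠ ∞ := ENNReal.sum_ne_top.1 (h.trans_lt ENNReal.ofReal_lt_top).ne
  have hsum : ∑ i ∈ s, (v i).toReal ≤ c := by
    rw [← ENNReal.toReal_sum hv]
    exact ENNReal.toReal_le_of_le_ofReal hc h
  calc ENNReal.ofReal (Real.exp (-(K * c)))
      ≤ ENNReal.ofReal (Real.exp (∑ i ∈ s, -(K * (v i).toReal))) := by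
        refine ENNReal.ofReal_le_ofReal (Real.exp_le_exp.2 ?_)
        rw [Finset.sum_neg_distrib, ← Finset.mul_sum]
        gcongr
    _ = ∏ i ∈ s, ENNReal.ofReal (Real.exp (-(K * (v i).toReal))) := by
        rw [Real.exp_sum, ENNReal.ofReal_prod_of_nonneg fun i _ => (Real.exp_pos _).le]
    _ ≤ ∏ i ∈ s, (1 + ENNReal.ofReal K * v i)⁻¹ := by
        refine Finset.prod_le_prod' fun i hi => ?_
        rw [Real.exp_neg, ENNReal.ofReal_inv_of_pos (Real.exp_pos _), ENNReal.inv_le_inv]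
        calc 1 + ENNReal.ofReal K * v i
            = ENNReal.ofReal (1 + K * (v i).toReal) := by
              rw [ENNReal.ofReal_add zero_le_one (by positivity), ENNReal.ofReal_one,
                ENNReal.ofReal_mul hK, ENNReal.ofReal_toReal (hv i hi)]
          _ ≤ _ := by
              refine ENNReal.ofReal_le_ofReal ?_
              linarith [Real.add_one_le_exp (K * (v i).toReal)]

/-! ### The exponential supermartingale and the good-`λ` inequality. -/

section GoodLambda

variable {Ω X : Type*} [NormedAddCommGroup X] [NormedSpace ℝ X] [CompleteSpace X]
  {m0 : MeasurableSpace Ω} {μ : Measure Ω} [IsFiniteMeasure μ] {ℱ : Filtration ℕ m0} {D : ℝ}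
  {V : ℕ → Ω → X →L[ℝ] X} {f d : ℕ → Ω → X} {v : ℕ → Ω → ℝ≥0∞} {t a r l : ℝ}

/-- Induction in time over three pieces: where `f` has just exceeded `t` the process is `0` and the
integrand is at most `1`; where it is frozen the product only decreases; where it moves, the
one-step bound applies. -/
theorem IsTwoSmooth.setLIntegral_restart_le (hX : IsTwoSmooth X D)
    (hV : ∀ n ω, ‖V n ω‖ ≤ 1) (hVm : ∀ n x, StronglyMeasurable[ℱ n] (fun ω => V n ω x))
    (hf : ∀ n, StronglyMeasurable[ℱ n] (f n)) (hdm : ∀ n, StronglyMeasurable[ℱ (n + 1)] (d n))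
    (hd : ∀ n, MemLp (d n) 2 μ) (hd0 : ∀ n G, MeasurableSet[ℱ n] G → ∫ ω in G, d n ω ∂μ = 0)
    (hv : ∀ n, Measurable[ℱ n] (v n))
    (hvd : ∀ n G, MeasurableSet[ℱ n] G → ∫⁻ ω in G, v n ω ∂μ = ∫⁻ ω in G, ‖d n ω‖ₑ ^ 2 ∂μ)
    (hl : 0 < l) (ha : 0 < a) (hr : 0 ≤ r) (hla : 1 ≤ Real.sinh (l * a)) (n : ℕ) :
    ∫⁻ ω in exceedSet f t n, coshNorm l (restart V f d t a r n ω) *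
        ∏ i ∈ Finset.range n,
          (1 + ENNReal.ofReal (D ^ 2 * (l * Real.sinh (l * a) / a)) * v i ω)⁻¹ ∂μ
      ≤ μ (exceedSet f t n) := by
  set K := ENNReal.ofReal (D ^ 2 * (l * Real.sinh (l * a) / a)) with hK
  set h := restart V f d t a r with hh
  set P : ℕ → Ω → ℝ≥0∞ := fun n ω => ∏ i ∈ Finset.range n, (1 + K * v i ω)⁻¹ with hP
  have hP1 : ∀ n ω, P n ω ≤ 1 := fun n ω => Finset.prod_le_one' fun i _ => by
    simp
  have hPs : ∀ n ω, P (n + 1) ω = P n ω * (1 + K * v n ω)⁻¹ := fun n ω =>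
    Finset.prod_range_succ _ _
  have hPm : ∀ n, Measurable[ℱ n] (P n) := fun n =>
    Finset.measurable_fun_prod _ fun i hi =>
      ((((hv i).mono (ℱ.mono (Finset.mem_range.1 hi).le) le_rfl).const_mul K).const_add 1).inv
  have hN : ∀ n, MeasurableSet[ℱ n] (exceedSet f t n) := measurableSet_exceedSet hf t
  have hN0 : ∀ n, MeasurableSet[m0] (exceedSet f t n) := fun n => ℱ.le n _ (hN n)
  have hhm : ∀ n, StronglyMeasurable[ℱ n] (h n) := stronglyMeasurable_restart hVm hf hdm
  induction n with
  | zero =>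
    calc ∫⁻ ω in exceedSet f t 0, coshNorm l (h 0 ω) * P 0 ω ∂μ
        = ∫⁻ _ in exceedSet f t 0, 1 ∂μ := by
          simp [hh, hP, restart, coshNorm]
      _ = _ := by simp
      _ ≤ _ := le_rfl
  | succ n ih =>
    set G := {ω | ‖h n ω‖ ≤ r} with hG
    have hGm : MeasurableSet[ℱ n] G := measurableSet_le (hhm n).norm.measurable measurable_const
    have hNG : MeasurableSet[ℱ n] (exceedSet f t n ∩ G) := (hN n).inter hGm
    have new : ∫⁻ ω in exceedSet f t (n + 1) \ exceedSet f t n,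
        coshNorm l (h (n + 1) ω) * P (n + 1) ω ∂μ ≤
          μ (exceedSet f t (n + 1) \ exceedSet f t n) := by
      rw [← setLIntegral_one]
      refine setLIntegral_mono' ((hN0 _).diff (hN0 _)) fun ω hω => ?_
      rw [hh, restart_succ_eq_zero hω.2]
      simpa [coshNorm] using hP1 (n + 1) ω
    have frozen : ∫⁻ ω in exceedSet f t n \ G, coshNorm l (h (n + 1) ω) * P (n + 1) ω ∂μ ≤
        ∫⁻ ω in exceedSet f t n \ G, coshNorm l (h n ω) * P n ω ∂μ := by
      refine setLIntegral_mono' ((hN0 _).diff (ℱ.le n _ hGm)) fun ω hω => ?_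
      rw [hh, restart_succ_of_not fun h' => hω.2 h'.2, hPs]
      gcongr
      exact mul_le_of_le_one_right' (by simp)
    have active : ∫⁻ ω in exceedSet f t n ∩ G, coshNorm l (h (n + 1) ω) * P (n + 1) ω ∂μ ≤
        ∫⁻ ω in exceedSet f t n ∩ G, coshNorm l (h n ω) * P n ω ∂μ := by
      have hx := stronglyMeasurable_clm_apply (hVm n) (hhm n)
      have hVh : ∀ ω, ‖V n ω (h n ω)‖ ≤ ‖h n ω‖ := fun ω => by
        simpa using (V n ω).le_of_opNorm_le (hV n ω) (h n ω)
      have step := hX.lintegral_mul_coshNorm_add_truncate_le (ℱ.le n) hl ha hla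
        ((hdm n).mono (ℱ.le _)) (hd n) (hd0 n) (hv n) (hvd n) hx (R := r + a)
        (fun ω => (hVh ω).trans (norm_restart_le ha.le hr hV n ω))
        -- The weight already contains the new inverse factor, known at time `n`; it cancels the
        -- growth factor of the one-step bound.
        (W := (exceedSet f t n ∩ G).indicator fun ω => P n ω * (1 + K * v n ω)⁻¹)
        (((hPm n).mul ((((hv n).const_mul K).const_add 1).inv)).indicator hNG)
      rw [← lintegral_indicator (ℱ.le n _ hNG), ← lintegral_indicator (ℱ.le n _ hNG)]
      refine le_trans (le_of_eq (lintegral_congr fun ω => ?_)) (step.trans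
        (lintegral_mono fun ω => ?_))
      · by_cases hω : ω ∈ exceedSet f t n ∩ G
        · rw [Set.indicator_of_mem hω, Set.indicator_of_mem hω, hh,
            restart_succ_of_mem hω.1 hω.2, hPs, mul_comm]
        · rw [Set.indicator_of_notMem hω, Set.indicator_of_notMem hω, zero_mul]
      · by_cases hω : ω ∈ exceedSet f t n ∩ G
        · rw [Set.indicator_of_mem hω, Set.indicator_of_mem hω]
          calc P n ω * (1 + K * v n ω)⁻¹ * (coshNorm l (V n ω (h n ω)) * (1 + K * v n ω))
              = coshNorm l (V n ω (h n ω)) * P n ω *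
                  ((1 + K * v n ω)⁻¹ * (1 + K * v n ω)) := by ring
            _ ≤ coshNorm l (h n ω) * P n ω * 1 := by
                gcongr
                · exact coshNorm_mono hl.le (hVh ω)
                · exact ENNReal.inv_mul_le_one _
            _ = _ := mul_one _
        · rw [Set.indicator_of_notMem hω, Set.indicator_of_notMem hω, zero_mul]
    have hsub := exceedSet_mono f t n.le_succ
    calc ∫⁻ ω in exceedSet f t (n + 1), coshNorm l (h (n + 1) ω) * P (n + 1) ω ∂μ
        = ∫⁻ ω in exceedSet f t n, coshNorm l (h (n + 1) ω) * P (n + 1) ω ∂μ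
          + ∫⁻ ω in exceedSet f t (n + 1) \ exceedSet f t n,
              coshNorm l (h (n + 1) ω) * P (n + 1) ω ∂μ := by
          rw [← lintegral_inter_add_sdiff _ _ (hN0 n), Set.inter_eq_self_of_subset_right hsub]
      _ ≤ μ (exceedSet f t n) + μ (exceedSet f t (n + 1) \ exceedSet f t n) := by
          refine add_le_add (le_trans ?_ ih) new
          rw [← lintegral_inter_add_sdiff _ (exceedSet f t n) (ℱ.le n _ hGm),
            ← lintegral_inter_add_sdiff (fun ω => coshNorm l (h n ω) * P n ω) (exceedSet f t n)
              (ℱ.le n _ hGm)]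
          exact add_le_add active frozen
      _ = μ (exceedSet f t (n + 1)) := by
          rw [← measure_inter_add_sdiff (exceedSet f t (n + 1)) (hN0 n),
            Set.inter_eq_self_of_subset_right hsub]

/-- The good-`λ` inequality. -/
theorem IsTwoSmooth.measure_exceedSet_inter_le (hX : IsTwoSmooth X D)
    (hV : ∀ n ω, ‖V n ω‖ ≤ 1) (hVm : ∀ n x, StronglyMeasurable[ℱ n] (fun ω => V n ω x))
    (hf : ∀ n, StronglyMeasurable[ℱ n] (f n)) (hdm : ∀ n, StronglyMeasurable[ℱ (n + 1)] (d n))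
    (hd : ∀ n, MemLp (d n) 2 μ) (hd0 : ∀ n G, MeasurableSet[ℱ n] G → ∫ ω in G, d n ω ∂μ = 0)
    (hv : ∀ n, Measurable[ℱ n] (v n))
    (hvd : ∀ n G, MeasurableSet[ℱ n] G → ∫⁻ ω in G, v n ω ∂μ = ∫⁻ ω in G, ‖d n ω‖ₑ ^ 2 ∂μ)
    (hf0 : ∀ᵐ ω ∂μ, f 0 ω = 0) (hrec : ∀ n, ∀ᵐ ω ∂μ, f (n + 1) ω = V n ω (f n ω) + d n ω)
    (hl : 0 < l) (ha : 0 < a) (hr : 0 ≤ r) (ht : 0 ≤ t) (hla : 1 ≤ Real.sinh (l * a))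
    {c : ℝ} (hc : 0 ≤ c) (N : ℕ) :
    μ (exceedSet f (t + a + r) N ∩ {ω | (∀ n < N, ‖d n ω‖ ≤ a) ∧
        ∑ i ∈ Finset.range N, v i ω ≤ ENNReal.ofReal c}) ≤
      ENNReal.ofReal (2 * Real.exp (D ^ 2 * (l * Real.sinh (l * a) / a) * c - l * r)) *
        μ (exceedSet f t N) := by
  set K := D ^ 2 * (l * Real.sinh (l * a) / a) with hK
  have hK0 : 0 ≤ K := by positivity
  set S := exceedSet f (t + a + r) N ∩ {ω | (∀ n < N, ‖d n ω‖ ≤ a) ∧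
        ∑ i ∈ Finset.range N, v i ω ≤ ENNReal.ofReal c} with hS
  set q := Real.exp (l * r - K * c) / 2 with hq
  have hq0 : 0 < q := by positivity
  have hSt : S ⊆ exceedSet f t N := fun ω hω => by
    obtain ⟨n, hn, h⟩ := hω.1
    exact ⟨n, hn, by linarith⟩
  have main := hX.setLIntegral_restart_le hV hVm hf hdm hd hd0 hv hvd hl ha hr hla (t := t) N
  have hae : ∀ᵐ ω ∂μ, f 0 ω = 0 ∧ ∀ n, f (n + 1) ω = V n ω (f n ω) + d n ω :=
    hf0.and (ae_all_iff.2 hrec)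
  have hSm : MeasurableSet S := by
    refine (ℱ.le N _ (measurableSet_exceedSet hf _ N)).inter ?_
    have e : {ω | (∀ n < N, ‖d n ω‖ ≤ a) ∧ ∑ i ∈ Finset.range N, v i ω ≤ ENNReal.ofReal c}
      = (⋂ n ∈ Set.Iio N, {ω | ‖d n ω‖ ≤ a}) ∩
        {ω | ∑ i ∈ Finset.range N, v i ω ≤ ENNReal.ofReal c} := by
      ext ω
      simp
    rw [e]
    refine MeasurableSet.inter (MeasurableSet.biInter (Set.to_countable _) fun n _ =>
      measurableSet_le ((hdm n).mono (ℱ.le _)).norm.measurable measurable_const) ?_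
    exact measurableSet_le (Finset.measurable_fun_sum _ fun i _ => (hv i).mono (ℱ.le i) le_rfl)
      measurable_const
  -- Markov's inequality: on `S` the process ends above `r` and the product is at least `exp (-(K *
  -- c))`, so the integrand is at least `q`.
  have lower : ENNReal.ofReal q * μ S ≤ μ (exceedSet f t N) := by
    refine le_trans ?_ main
    calc ENNReal.ofReal q * μ S = ∫⁻ _ in S, ENNReal.ofReal q ∂μ := by simp
      _ ≤ ∫⁻ ω in S, coshNorm l (restart V f d t a r N ω) *
            ∏ i ∈ Finset.range N, (1 + ENNReal.ofReal K * v i ω)⁻¹ ∂μ := by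
          refine lintegral_mono_ae ?_
          filter_upwards [ae_restrict_mem hSm, ae_restrict_of_ae hae] with ω hω hae
          have h1 := lt_norm_restart ht ha.le (hV · ω) hae.1 hae.2 hω.2.1 hω.1
          have h2 := exp_neg_le_prod_inv _ hK0 hc hω.2.2
          calc ENNReal.ofReal q
              = ENNReal.ofReal (Real.exp (l * r) / 2) * ENNReal.ofReal (Real.exp (-(K * c))) := by
                rw [← ENNReal.ofReal_mul (by positivity), hq, sub_eq_add_neg, Real.exp_add]
                congr 1
                ring
            _ ≤ _ := by
                refine mul_le_mul' (ENNReal.ofReal_le_ofReal ?_) h2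
                have h3 : Real.exp (l * r) ≤ Real.exp (l * ‖restart V f d t a r N ω‖) := by
                  gcongr
                rw [Real.cosh_eq]
                linarith [Real.exp_pos (-(l * ‖restart V f d t a r N ω‖))]
      _ ≤ _ := lintegral_mono_set hSt
  have hinv : ENNReal.ofReal (2 * Real.exp (K * c - l * r)) = (ENNReal.ofReal q)⁻¹ := by
    rw [← ENNReal.ofReal_inv_of_pos hq0, hq, inv_div, div_eq_mul_inv, ← Real.exp_neg, neg_sub]
  rw [hinv, mul_comm, ← div_eq_mul_inv]
  rw [ENNReal.le_div_iff_mul_le (Or.inl (by simpa using hq0)) (Or.inl ENNReal.ofReal_ne_top),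
    mul_comm]
  exact lower

end GoodLambda

/-! ### From tail inequalities to moments. -/

section LayerCake

variable {Ω : Type*} {m0 : MeasurableSpace Ω} {μ : Measure Ω}

/-- The layer cake formula at scale `c` for almost everywhere finite functions. -/
theorem lintegral_rpow_eq_lintegral_meas_lt_smul {F : Ω → ℝ≥0∞} (hF : AEMeasurable F μ)
    (hFt : ∀ᵐ ω ∂μ, F ω ≠ ∞) {p c : ℝ} (hp : 0 < p) (hc : 0 < c) :
    ∫⁻ ω, F ω ^ p ∂μ = ENNReal.ofReal c ^ p * (ENNReal.ofReal p *
      ∫⁻ t in Set.Ioi (0 : ℝ), μ {ω | ENNReal.ofReal (c * t) < F ω} *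
        ENNReal.ofReal (t ^ (p - 1))) := by
  have h := lintegral_rpow_eq_lintegral_meas_lt_mul μ (f := fun ω => (F ω).toReal / c)
    (Eventually.of_forall fun ω => by positivity) (hF.ennreal_toReal.div_const c) hp
  have e1 : ∫⁻ ω, F ω ^ p ∂μ =
      ENNReal.ofReal c ^ p * ∫⁻ ω, ENNReal.ofReal (((F ω).toReal / c) ^ p) ∂μ := by
    rw [← lintegral_const_mul' _ _ (ENNReal.rpow_ne_top_of_nonneg hp.le ENNReal.ofReal_ne_top)]
    refine lintegral_congr_ae ?_
    filter_upwards [hFt] with ω hω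
    rw [← ENNReal.ofReal_rpow_of_nonneg (by positivity) hp.le, ← ENNReal.mul_rpow_of_nonneg _ _ hp.le,
      ← ENNReal.ofReal_mul hc.le, mul_div_cancel₀ _ hc.ne', ENNReal.ofReal_toReal hω]
  rw [e1, h]
  congr 2
  refine setLIntegral_congr_fun measurableSet_Ioi fun t ht => ?_
  have ht : 0 < t := ht
  congr 1
  refine measure_congr ?_
  filter_upwards [hFt] with ω hω
  refine propext ?_
  change t < (F ω).toReal / c ↔ ENNReal.ofReal (c * t) < F ω
  rw [lt_div_iff₀ hc, mul_comm, ENNReal.ofReal_lt_iff_lt_toReal (by positivity) hω]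

/-- A good-`λ` inequality for all levels yields a bound for the `p`-th moments. -/
theorem lintegral_rpow_le_of_meas_lt_le {F G S : Ω → ℝ≥0∞} (hF : AEMeasurable F μ)
    (hG : AEMeasurable G μ) (hS : AEMeasurable S μ) (hFt : ∀ᵐ ω ∂μ, F ω ≠ ∞)
    (hGt : ∀ᵐ ω ∂μ, G ω ≠ ∞) (hSt : ∀ᵐ ω ∂μ, S ω ≠ ∞) {p b δ δ' : ℝ} {e : ℝ≥0∞} (hp : 0 < p)
    (hb : 0 < b) (hδ : 0 < δ) (hδ' : 0 < δ')
    (h : ∀ t : ℝ, 0 < t → μ {ω | ENNReal.ofReal (b * t) < F ω} ≤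
      e * μ {ω | ENNReal.ofReal t < F ω} + μ {ω | ENNReal.ofReal (δ * t) < G ω}
        + μ {ω | ENNReal.ofReal (δ' * t) < S ω}) :
    ∫⁻ ω, F ω ^ p ∂μ ≤ ENNReal.ofReal b ^ p * (e * ∫⁻ ω, F ω ^ p ∂μ +
      ENNReal.ofReal δ⁻¹ ^ p * ∫⁻ ω, G ω ^ p ∂μ + ENNReal.ofReal δ'⁻¹ ^ p * ∫⁻ ω, S ω ^ p ∂μ) := by
  have hm : ∀ (H : Ω → ℝ≥0∞) {c : ℝ}, 0 < c →
      Measurable fun t : ℝ => μ {ω | ENNReal.ofReal (c * t) < H ω} := fun H c hc =>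
    Antitone.measurable fun s t hst => measure_mono fun ω hω => lt_of_le_of_lt
      (ENNReal.ofReal_le_ofReal (by gcongr)) hω
  have hmp : ∀ (H : Ω → ℝ≥0∞) {c : ℝ}, 0 < c → Measurable fun t : ℝ =>
      μ {ω | ENNReal.ofReal (c * t) < H ω} * ENNReal.ofReal (t ^ (p - 1)) := fun H c hc =>
    (hm H hc).mul (by fun_prop)
  have hm1 := hmp F one_pos
  simp only [one_mul] at hm1
  have inv : ∀ (H : Ω → ℝ≥0∞) {c : ℝ}, AEMeasurable H μ → (∀ᵐ ω ∂μ, H ω ≠ ∞) → 0 < c →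
      ENNReal.ofReal p * ∫⁻ t in Set.Ioi (0 : ℝ), μ {ω | ENNReal.ofReal (c * t) < H ω} *
        ENNReal.ofReal (t ^ (p - 1)) = ENNReal.ofReal c⁻¹ ^ p * ∫⁻ ω, H ω ^ p ∂μ := by
    intro H c hH hHt hc
    rw [lintegral_rpow_eq_lintegral_meas_lt_smul hH hHt hp hc, ← mul_assoc,
      ← ENNReal.mul_rpow_of_nonneg _ _ hp.le, ← ENNReal.ofReal_mul (by positivity),
      inv_mul_cancel₀ hc.ne', ENNReal.ofReal_one, ENNReal.one_rpow, one_mul]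
  have e1 := inv F hF hFt one_pos
  simp only [one_mul, inv_one, ENNReal.ofReal_one, ENNReal.one_rpow] at e1
  rw [lintegral_rpow_eq_lintegral_meas_lt_smul hF hFt hp hb]
  refine mul_le_mul_right ?_ _
  rw [← lintegral_rpow_eq_lintegral_meas_lt_smul hF hFt hp hb, ← e1, ← inv G hG hGt hδ,
    ← inv S hS hSt hδ', mul_left_comm, ← mul_add, ← mul_add]
  refine mul_le_mul_right ?_ _
  rw [← lintegral_const_mul _ hm1, ← lintegral_add_left (hm1.const_mul e),
    ← lintegral_add_right _ (hmp S hδ')]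
  refine setLIntegral_mono' measurableSet_Ioi fun t ht => ?_
  rw [← mul_assoc, ← add_mul, ← add_mul]
  exact mul_le_mul_left (h t ht) _

end LayerCake

/-! ### Numerical constants and absorption. -/

/-- The numerical estimate behind the constants `5` and `10`. -/
theorem three_rpow_mul_exp_le {p : ℝ} (hp : 2 ≤ p) :
    (3 : ℝ) ^ p * (2 * Real.exp (3 / 8 * Real.sinh (3 / 2) * p - (25 / 6 * p - 3 / 2))) ≤
      11 / 36 := by
  have h1 : (2.7 : ℝ) ≤ Real.exp 1 := by linarith [Real.exp_one_gt_d9]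
  have h1' : Real.exp 1 ≤ 2.72 := by linarith [Real.exp_one_lt_d9]
  have h3 : (3 : ℝ) ≤ Real.exp (6 / 5) := by
    have h5 := Real.add_one_le_exp (1 / 5 : ℝ)
    have : Real.exp (6 / 5) = Real.exp 1 * Real.exp (1 / 5) := by
      rw [← Real.exp_add]
      norm_num
    rw [this]
    nlinarith
  have hs : Real.sinh (3 / 2) ≤ 2.26 := by
    have h6 : Real.exp (3 / 2) ^ 2 = Real.exp 1 ^ 3 := by
      rw [← Real.exp_nat_mul, ← Real.exp_nat_mul]
      norm_num
    have h7 : Real.exp 1 ^ 3 ≤ 2.72 ^ 3 := pow_le_pow_left₀ (Real.exp_pos _).le h1' 3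
    have h8 : Real.exp (3 / 2) ≤ 4.52 := by
      refine le_of_sq_le_sq ?_ (by norm_num)
      rw [h6]
      exact h7.trans (by norm_num)
    rw [Real.sinh_eq]
    linarith [Real.exp_pos (-(3 / 2 : ℝ))]
  -- With `3 ≤ exp (6 / 5)` and `sinh (3 / 2) ≤ 2.26` the total exponent is at most `3 / 2 - 2.11 *
  -- p`, which is below `-2` for `p ≥ 2`.
  calc (3 : ℝ) ^ p * (2 * Real.exp (3 / 8 * Real.sinh (3 / 2) * p - (25 / 6 * p - 3 / 2)))
      ≤ Real.exp (6 / 5) ^ p *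
          (2 * Real.exp (3 / 8 * Real.sinh (3 / 2) * p - (25 / 6 * p - 3 / 2))) := by
        gcongr
    _ = 2 * Real.exp (6 / 5 * p + (3 / 8 * Real.sinh (3 / 2) * p - (25 / 6 * p - 3 / 2))) := by
        rw [Real.exp_add, Real.exp_mul]
        ring
    _ ≤ 2 * Real.exp (-2) := by
        gcongr
        nlinarith
    _ ≤ 11 / 36 := by
        have h9 : Real.exp 2 = Real.exp 1 ^ 2 := by
          rw [← Real.exp_nat_mul]
          norm_num
        have h10 : (2.7 : ℝ) ^ 2 ≤ Real.exp 2 := by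
          rw [h9]
          gcongr
        rw [Real.exp_neg, ← div_eq_mul_inv, div_le_iff₀ (Real.exp_pos _)]
        linarith

/-- Absorption of the first term on the right, followed by taking `p`-th roots. -/
theorem rpow_le_of_absorb {x y z ε b A B : ℝ≥0∞} {p : ℝ} (hp : 2 ≤ p) (hx : x ≠ ∞)
    (hε : b ^ p * ε ≤ ENNReal.ofReal (11 / 36))
    (h : x ≤ b ^ p * (ε * x + A ^ p * y + B ^ p * z)) :
    x ^ (1 / p) ≤ ENNReal.ofReal (6 / 5) * b * (A * y ^ (1 / p) + B * z ^ (1 / p)) := by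
  have hp0 : 0 < p := by linarith
  set Y := A * y ^ (1 / p) with hY
  set Z := B * z ^ (1 / p) with hZ
  have hroot : ∀ w : ℝ≥0∞, (w ^ (1 / p)) ^ p = w := fun w => by
    rw [← ENNReal.rpow_mul, one_div_mul_cancel hp0.ne', ENNReal.rpow_one]
  have hYZ : A ^ p * y + B ^ p * z ≤ (Y + Z) ^ p := by
    refine le_trans (le_of_eq ?_) (ENNReal.add_rpow_le_rpow_add Y Z (by linarith))
    rw [hY, hZ, ENNReal.mul_rpow_of_nonneg _ _ hp0.le, ENNReal.mul_rpow_of_nonneg _ _ hp0.le,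
      hroot, hroot]
  have h1 : x ≤ ENNReal.ofReal (11 / 36) * x + b ^ p * (Y + Z) ^ p :=
    calc x ≤ b ^ p * (ε * x + A ^ p * y + B ^ p * z) := h
      _ = b ^ p * ε * x + b ^ p * (A ^ p * y + B ^ p * z) := by ring
      _ ≤ _ := by gcongr
  have h2 : ENNReal.ofReal (25 / 36) * x ≤ b ^ p * (Y + Z) ^ p := by
    refine (ENNReal.add_le_add_iff_left
      (a := ENNReal.ofReal (11 / 36) * x) (ENNReal.mul_ne_top ENNReal.ofReal_ne_top hx)).1 ?_
    rw [← add_mul, ← ENNReal.ofReal_add (by norm_num) (by norm_num)]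
    norm_num at h1 ⊢
    exact h1
  have h3 : x ≤ ENNReal.ofReal (6 / 5) ^ p * (b ^ p * (Y + Z) ^ p) :=
    calc x = ENNReal.ofReal (36 / 25) * (ENNReal.ofReal (25 / 36) * x) := by
          rw [← mul_assoc, ← ENNReal.ofReal_mul (by norm_num)]
          norm_num
      _ ≤ ENNReal.ofReal (6 / 5) ^ p * (b ^ p * (Y + Z) ^ p) := by
          refine mul_le_mul' ?_ h2
          rw [ENNReal.ofReal_rpow_of_nonneg (by norm_num) hp0.le]
          refine ENNReal.ofReal_le_ofReal ?_
          -- Absorbing `11 / 36` leaves the factor `36 / 25`, a square, so that `p ≥ 2` bounds its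
          -- `p`-th root by `6 / 5`.
          calc (36 / 25 : ℝ) = (6 / 5) ^ (2 : ℝ) := by norm_num
            _ ≤ _ := Real.rpow_le_rpow_of_exponent_le (by norm_num) hp
  rw [one_div, ENNReal.rpow_inv_le_iff hp0]
  rwa [mul_assoc, ENNReal.mul_rpow_of_nonneg _ _ hp0.le, ENNReal.mul_rpow_of_nonneg _ _ hp0.le]

/-! ### Passage to finite index sets and choice of parameters. -/

section Transfer

variable {Ω X : Type*} {m0 : MeasurableSpace Ω} {k : ℕ}

/-- The time `n`, stopped at `k`, as an element of `Fin (k + 1)`. -/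
def stopIndex (k n : ℕ) : Fin (k + 1) := ⟨min n k, by omega⟩

theorem stopIndex_mono (k : ℕ) : Monotone (stopIndex k) := fun _ _ h =>
  min_le_min_right k h

theorem stopIndex_of_lt {n : ℕ} (h : n < k) :
    stopIndex k n = (⟨n, h⟩ : Fin k).castSucc := by
  ext
  simp [stopIndex, h.le]

theorem stopIndex_succ_of_lt {n : ℕ} (h : n < k) :
    stopIndex k (n + 1) = (⟨n, h⟩ : Fin k).succ := by
  ext
  simpa [stopIndex] using h

theorem stopIndex_succ_of_not_lt {n : ℕ} (h : ¬ n < k) :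
    stopIndex k (n + 1) = stopIndex k n := by
  ext
  simp only [stopIndex]
  omega

/-- The filtration stopped at the final time `k`. -/
def stopFiltration (ℱ : Filtration (Fin (k + 1)) m0) : Filtration ℕ m0 where
  seq n := ℱ (stopIndex k n)
  mono' _ _ h := ℱ.mono (stopIndex_mono k h)
  le' _ := ℱ.le _

/-- A sequence indexed by `Fin k`, continued by the constant `c`. -/
def extendSeq {α : Type*} (u : Fin k → α) (c : α) (n : ℕ) : α :=
  if h : n < k then u ⟨n, h⟩ else c

theorem extendSeq_of_lt {α : Type*} (u : Fin k → α) (c : α) {n : ℕ} (h : n < k) :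
    extendSeq u c n = u ⟨n, h⟩ := dif_pos h

theorem extendSeq_of_not_lt {α : Type*} (u : Fin k → α) (c : α) {n : ℕ} (h : ¬ n < k) :
    extendSeq u c n = c := dif_neg h

variable [NormedAddCommGroup X]

theorem ofReal_lt_maximalFunction_iff {ι : Type*} {u : ι → Ω → X} {s : ℝ} (hs : 0 ≤ s) {ω : Ω} :
    ENNReal.ofReal s < maximalFunction u ω ↔ ∃ i, s < ‖u i ω‖ := by
  simp only [maximalFunction, lt_iSup_iff, ← ofReal_norm]
  exact exists_congr fun i => ENNReal.ofReal_lt_ofReal_iff_of_nonneg hs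

theorem mem_exceedSet_stopIndex_iff {f : Fin (k + 1) → Ω → X} {s : ℝ} (hs : 0 ≤ s) {ω : Ω} :
    ω ∈ exceedSet (fun n => f (stopIndex k n)) s k ↔ ENNReal.ofReal s < maximalFunction f ω := by
  rw [ofReal_lt_maximalFunction_iff hs]
  constructor
  · rintro ⟨n, -, h⟩
    exact ⟨_, h⟩
  · rintro ⟨i, h⟩
    have hi : stopIndex k i = i := by
      ext
      simpa [stopIndex] using Nat.lt_succ_iff.1 i.2
    exact ⟨i, Nat.lt_succ_iff.1 i.2, by simpa only [hi] using h⟩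

theorem measurable_maximalFunction {ι : Type*} [Countable ι] {u : ι → Ω → X}
    (hu : ∀ i, StronglyMeasurable (u i)) : Measurable (maximalFunction u) :=
  Measurable.iSup fun i => (hu i).enorm

theorem measurable_condSquareFunction {μ : Measure Ω} {ℱ : Filtration (Fin (k + 1)) m0}
    {g : Fin (k + 1) → Ω → X} : Measurable (condSquareFunction ℱ μ g) :=
  (Finset.measurable_fun_sum _ fun _ _ => measurable_condLExp' _ _ _).pow_const _

variable [NormedSpace ℝ X]

theorem stronglyMeasurable_diffSeq {μ : Measure Ω} {ℱ : Filtration (Fin (k + 1)) m0}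
    {g : Fin (k + 1) → Ω → X} (hg : Martingale g ℱ μ) (j : Fin k) :
    StronglyMeasurable[ℱ j.succ] (diffSeq g j) :=
  (hg.1 j.succ).sub ((hg.1 j.castSucc).mono (ℱ.mono j.castSucc_le_succ))

/-- A crude bound whose role is to make the `p`-th moment of the maximal function finite, as
absorption requires. -/
theorem enorm_le_mul_maximalFunction_diffSeq {V : Fin k → Ω → X →L[ℝ] X} {f g : Fin (k + 1) → Ω → X} {ω : Ω}
    (hV : ∀ j, ‖V j ω‖ ≤ 1) (h0 : f 0 ω = 0)
    (hrec : ∀ j : Fin k, f j.succ ω = V j ω (f j.castSucc ω) + diffSeq g j ω)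
    (i : Fin (k + 1)) : ‖f i ω‖ₑ ≤ i * maximalFunction (diffSeq g) ω := by
  induction i using Fin.induction with
  | zero => simp [h0]
  | succ j ih =>
    rw [hrec]
    refine (enorm_add_le _ _).trans ?_
    have h1 : ‖V j ω (f j.castSucc ω)‖ₑ ≤ ‖f j.castSucc ω‖ₑ := by
      rw [enorm_le_iff_norm_le]
      simpa using (V j ω).le_of_opNorm_le (hV j) (f j.castSucc ω)
    have h2 : ‖diffSeq g j ω‖ₑ ≤ maximalFunction (diffSeq g) ω :=
      le_iSup (fun i => ‖diffSeq g i ω‖ₑ) j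
    calc _ ≤ (j.castSucc : ℕ) * maximalFunction (diffSeq g) ω + maximalFunction (diffSeq g) ω :=
          add_le_add (h1.trans ih) h2
      _ = _ := by
          simp
          ring

variable [CompleteSpace X]

/-- The good-`λ` inequality for the maximal functions. -/
theorem IsTwoSmooth.measure_lt_maximalFunction_le {D : ℝ} (hX : IsTwoSmooth X D)
    {μ : Measure Ω} [IsProbabilityMeasure μ] (ℱ : Filtration (Fin (k + 1)) m0)
    (f g : Fin (k + 1) → Ω → X) (V : Fin k → Ω → X →L[ℝ] X)
    (hf : StronglyAdapted ℱ f) (hg : Martingale g ℱ μ) (hV : IsPredictableContraction ℱ V)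
    (hf0 : ∀ᵐ ω ∂μ, f 0 ω = 0)
    (hrec : ∀ j : Fin k, ∀ᵐ ω ∂μ, f j.succ ω = V j ω (f j.castSucc ω) + diffSeq g j ω)
    (hd : ∀ j, MemLp (diffSeq g j) 2 μ) {l a r t b : ℝ} (hl : 0 < l) (ha : 0 < a) (hr : 0 ≤ r)
    (ht : 0 ≤ t) (hb : 0 ≤ b) (hla : 1 ≤ Real.sinh (l * a)) :
    μ {ω | ENNReal.ofReal (t + a + r) < maximalFunction f ω} ≤
      ENNReal.ofReal (2 * Real.exp (D ^ 2 * (l * Real.sinh (l * a) / a) * b ^ 2 - l * r)) *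
          μ {ω | ENNReal.ofReal t < maximalFunction f ω}
        + μ {ω | ENNReal.ofReal a < maximalFunction (diffSeq g) ω}
        + μ {ω | ENNReal.ofReal b < condSquareFunction ℱ μ g ω} := by
  -- Past time `k` the sequence is continued with `V = id`, zero increments and zero variance, so
  -- the constant continuation of `f` obeys the recursion.
  set f' : ℕ → Ω → X := fun n => f (stopIndex k n) with hf'
  set d' : ℕ → Ω → X := extendSeq (diffSeq g) 0 with hd'
  set V' : ℕ → Ω → X →L[ℝ] X := extendSeq V fun _ => ContinuousLinearMap.id ℝ X with hV'
  set v' : ℕ → Ω → ℝ≥0∞ := extendSeq (fun j : Fin k =>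
    condLExp (ℱ j.castSucc) μ (fun ω' => ‖diffSeq g j ω'‖ₑ ^ 2)) 0 with hv'
  have main := hX.measure_exceedSet_inter_le (ℱ := stopFiltration ℱ) (V := V') (f := f') (d := d')
    (v := v') (μ := μ) (t := t) (a := a) (r := r) (l := l)
    (fun n ω => by
      by_cases h : n < k
      · rw [hV', extendSeq_of_lt _ _ h]
        exact hV.norm_le_one _ _
      · rw [hV', extendSeq_of_not_lt _ _ h]
        exact ContinuousLinearMap.norm_id_le)
    (fun n x => by
      by_cases h : n < k
      · rw [hV', extendSeq_of_lt _ _ h]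
        change StronglyMeasurable[ℱ (stopIndex k n)] _
        rw [stopIndex_of_lt h]
        exact hV.stronglyMeasurable _ _
      · rw [hV', extendSeq_of_not_lt _ _ h]
        exact stronglyMeasurable_const)
    (fun n => hf _)
    (fun n => by
      by_cases h : n < k
      · rw [hd', extendSeq_of_lt _ _ h]
        change StronglyMeasurable[ℱ (stopIndex k (n + 1))] _
        rw [stopIndex_succ_of_lt h]
        exact stronglyMeasurable_diffSeq hg _
      · rw [hd', extendSeq_of_not_lt _ _ h]
        exact stronglyMeasurable_const)
    (fun n => by
      by_cases h : n < k
      · rw [hd', extendSeq_of_lt _ _ h]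
        exact hd _
      · rw [hd', extendSeq_of_not_lt _ _ h]
        exact MemLp.zero)
    (fun n G hG => by
      by_cases h : n < k
      · rw [hd', extendSeq_of_lt _ _ h]
        change MeasurableSet[ℱ (stopIndex k n)] G at hG
        rw [stopIndex_of_lt h] at hG
        simp only [diffSeq]
        rw [integral_sub (hg.integrable _).integrableOn (hg.integrable _).integrableOn,
          hg.setIntegral_eq (Fin.castSucc_le_succ _) hG, sub_self]
      · rw [hd', extendSeq_of_not_lt _ _ h]
        simp)
    (fun n => by
      by_cases h : n < k
      · rw [hv', extendSeq_of_lt _ _ h]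
        change Measurable[ℱ (stopIndex k n)] _
        rw [stopIndex_of_lt h]
        exact measurable_condLExp _ _ _
      · rw [hv', extendSeq_of_not_lt _ _ h]
        exact measurable_const)
    (fun n G hG => by
      by_cases h : n < k
      · rw [hv', hd', extendSeq_of_lt _ _ h, extendSeq_of_lt _ _ h]
        change MeasurableSet[ℱ (stopIndex k n)] G at hG
        rw [stopIndex_of_lt h] at hG
        exact setLIntegral_condLExp (ℱ.le _) μ _ hG
      · rw [hv', hd', extendSeq_of_not_lt _ _ h, extendSeq_of_not_lt _ _ h]
        simp)
    (by simpa [hf', stopIndex] using hf0)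
    (fun n => by
      by_cases h : n < k
      · simp only [hV', hd', hf', extendSeq_of_lt _ _ h, stopIndex_of_lt h, stopIndex_succ_of_lt h]
        exact hrec _
      · simp [hV', hd', hf', extendSeq_of_not_lt _ _ h, stopIndex_succ_of_not_lt h])
    hl ha hr ht hla (sq_nonneg b) k
  have e1 : exceedSet f' t k = {ω | ENNReal.ofReal t < maximalFunction f ω} :=
    Set.ext fun ω => mem_exceedSet_stopIndex_iff ht
  have e2 : exceedSet f' (t + a + r) k = {ω | ENNReal.ofReal (t + a + r) < maximalFunction f ω} :=
    Set.ext fun ω => mem_exceedSet_stopIndex_iff (by positivity)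
  rw [e1, e2] at main
  refine le_trans (measure_mono fun ω hω => ?_) ((measure_union_le _ _).trans
    (add_le_add_left ((measure_union_le _ _).trans (add_le_add_left main _)) _))
  by_cases h1 : ENNReal.ofReal a < maximalFunction (diffSeq g) ω
  · exact Or.inl (Or.inr h1)
  by_cases h2 : ENNReal.ofReal b < condSquareFunction ℱ μ g ω
  · exact Or.inr h2
  refine Or.inl (Or.inl ⟨hω, fun n hn => ?_, ?_⟩)
  · rw [ofReal_lt_maximalFunction_iff ha.le] at h1
    push Not at h1
    rw [hd', extendSeq_of_lt _ _ hn]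
    exact h1 _
  · rw [Finset.sum_range]
    have h3 := not_lt.1 h2
    rw [condSquareFunction, one_div, ENNReal.rpow_inv_le_iff two_pos, ENNReal.rpow_two,
      ← ENNReal.ofReal_pow hb] at h3
    refine le_trans (le_of_eq (Finset.sum_congr rfl fun j _ => ?_)) h3
    rw [hv', extendSeq_of_lt _ _ j.2]

theorem IsTwoSmooth.eLpNorm_maximalFunction_le {D : ℝ} (hX : IsTwoSmooth X D)
    {μ : Measure Ω} [IsProbabilityMeasure μ] (ℱ : Filtration (Fin (k + 1)) m0)
    (f g : Fin (k + 1) → Ω → X) (V : Fin k → Ω → X →L[ℝ] X)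
    (hf : StronglyAdapted ℱ f) (hg : Martingale g ℱ μ) (hV : IsPredictableContraction ℱ V)
    (hf0 : ∀ᵐ ω ∂μ, f 0 ω = 0)
    (hrec : ∀ j : Fin k, ∀ᵐ ω ∂μ, f j.succ ω = V j ω (f j.castSucc ω) + diffSeq g j ω)
    {p : ℝ} (hp : 2 ≤ p) :
    eLpNorm (maximalFunction f) (ENNReal.ofReal p) μ ≤
      ENNReal.ofReal (5 * p) * eLpNorm (maximalFunction (diffSeq g)) (ENNReal.ofReal p) μ
        + ENNReal.ofReal (10 * D * √p) *
          eLpNorm (condSquareFunction ℱ μ g) (ENNReal.ofReal p) μ := by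
  have hD : 0 < D := one_pos.trans_le hX.1
  have hp0 : 0 < p := by linarith
  have hsp : 0 < √p := Real.sqrt_pos.2 hp0
  have hpne : ENNReal.ofReal p ≠ 0 := by simpa using hp0
  have hnorm : ∀ H : Ω → ℝ≥0∞, eLpNorm H (ENNReal.ofReal p) μ = (∫⁻ ω, H ω ^ p ∂μ) ^ (1 / p) := by
    intro H
    rw [eLpNorm_eq_lintegral_rpow_enorm_toReal hpne ENNReal.ofReal_ne_top,
      ENNReal.toReal_ofReal hp0.le]
    simp only [enorm_eq_self]
  by_cases hGtop : eLpNorm (maximalFunction (diffSeq g)) (ENNReal.ofReal p) μ = ∞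
  · rw [hGtop, ENNReal.mul_top (by simpa using hp0), top_add]
    exact le_top
  by_cases hStop : eLpNorm (condSquareFunction ℱ μ g) (ENNReal.ofReal p) μ = ∞
  · rw [hStop, ENNReal.mul_top (by simpa using (by positivity : 0 < 10 * D * √p)), add_top]
    exact le_top
  set F := maximalFunction f with hF
  set G := maximalFunction (diffSeq g) with hG
  set S := condSquareFunction ℱ μ g with hS
  have hdm : ∀ j, StronglyMeasurable (diffSeq g j) := fun j =>
    (stronglyMeasurable_diffSeq hg j).mono (ℱ.le _)
  have hFm : Measurable F := measurable_maximalFunction fun i => (hf i).mono (ℱ.le i)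
  have hGm : Measurable G := measurable_maximalFunction hdm
  have hSm : Measurable S := measurable_condSquareFunction
  have hfin : ∀ H : Ω → ℝ≥0∞, eLpNorm H (ENNReal.ofReal p) μ ≠ ∞ → ∫⁻ ω, H ω ^ p ∂μ ≠ ∞ := by
    intro H hH h
    rw [hnorm, h, ENNReal.top_rpow_of_pos (by positivity)] at hH
    exact hH rfl
  have hae : ∀ H : Ω → ℝ≥0∞, Measurable H → ∫⁻ ω, H ω ^ p ∂μ ≠ ∞ → ∀ᵐ ω ∂μ, H ω ≠ ∞ := by
    intro H hHm hH
    filter_upwards [ae_lt_top (hHm.pow_const p) hH] with ω hω h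
    rw [h, ENNReal.top_rpow_of_pos hp0] at hω
    exact lt_irrefl _ hω
  have hIG := hfin G hGtop
  have hIS := hfin S hStop
  have hFG : ∀ᵐ ω ∂μ, F ω ≤ k * G ω := by
    filter_upwards [hf0, ae_all_iff.2 hrec] with ω h0 hr
    refine iSup_le fun i => (enorm_le_mul_maximalFunction_diffSeq (hV.norm_le_one · ω) h0 hr i).trans ?_
    gcongr
    exact Nat.lt_succ_iff.1 i.2
  have hIF : ∫⁻ ω, F ω ^ p ∂μ ≠ ∞ := by
    refine ne_top_of_le_ne_top (b := (k : ℝ≥0∞) ^ p * ∫⁻ ω, G ω ^ p ∂μ)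
      (ENNReal.mul_ne_top (ENNReal.rpow_ne_top_of_nonneg hp0.le (by simp)) hIG) ?_
    rw [← lintegral_const_mul _ (hGm.pow_const p)]
    refine lintegral_mono_ae ?_
    filter_upwards [hFG] with ω hω
    rw [← ENNReal.mul_rpow_of_nonneg _ _ hp0.le]
    gcongr
  -- Square integrability comes from the `L^p` bound on the maximal jump, as `p ≥ 2` on a
  -- probability space.
  have hd : ∀ j, MemLp (diffSeq g j) 2 μ := fun j => by
    refine ⟨(hdm j).aestronglyMeasurable, ?_⟩
    calc eLpNorm (diffSeq g j) 2 μ ≤ eLpNorm (diffSeq g j) (ENNReal.ofReal p) μ :=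
          eLpNorm_le_eLpNorm_of_exponent_le (by simpa using ENNReal.ofReal_le_ofReal hp)
            (hdm j).aestronglyMeasurable
      _ ≤ eLpNorm G (ENNReal.ofReal p) μ := eLpNorm_mono_enorm fun ω => by
          exact (le_iSup (fun i => ‖diffSeq g i ω‖ₑ) j).trans_eq (enorm_eq_self _).symm
      _ < ∞ := lt_top_iff_ne_top.2 hGtop
  -- Chosen so that `6 / 5 * 3 / δ = 5 * p` and `6 / 5 * 3 / δ' = 10 * D * √p`, with `3` the ratio
  -- of levels and `6 / 5` the cost of absorption.
  set δ := 18 / (25 * p) with hδ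
  set δ' := 9 / (25 * D * √p) with hδ'
  set e := 2 * Real.exp (3 / 8 * Real.sinh (3 / 2) * p - (25 / 6 * p - 3 / 2)) with he
  have hδ0 : 0 < δ := by positivity
  have hδ0' : 0 < δ' := by positivity
  have hδ1 : δ ≤ 1 := by
    rw [hδ, div_le_one (by positivity)]
    linarith
  have good : ∀ t : ℝ, 0 < t → μ {ω | ENNReal.ofReal (3 * t) < F ω} ≤
      ENNReal.ofReal e * μ {ω | ENNReal.ofReal t < F ω} + μ {ω | ENNReal.ofReal (δ * t) < G ω}
        + μ {ω | ENNReal.ofReal (δ' * t) < S ω} := by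
    intro t ht
    have ha : 0 < δ * t := by positivity
    have hla : 3 / (2 * (δ * t)) * (δ * t) = 3 / 2 := by field_simp
    -- `r` makes the upper level `3 * t`, and `l` makes `l * a = 3 / 2`, whose `sinh` exceeds `1`.
    -- The exponent no longer depends on `t` or `D`, because `D ^ 2 * δ' ^ 2 / δ ^ 2 = p / 4`.
    have h := hX.measure_lt_maximalFunction_le ℱ f g V hf hg hV hf0 hrec hd
      (l := 3 / (2 * (δ * t))) (a := δ * t) (r := (2 - δ) * t) (t := t) (b := δ' * t)
      (by positivity) ha (mul_nonneg (by linarith) ht.le) ht.le (by positivity)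
      (by
        rw [hla]
        linarith [Real.self_le_sinh_iff.2 (show (0 : ℝ) ≤ 3 / 2 by norm_num)])
    rw [hla] at h
    have e1 : t + δ * t + (2 - δ) * t = 3 * t := by ring
    have e2 : D ^ 2 * (3 / (2 * (δ * t)) * Real.sinh (3 / 2) / (δ * t)) * (δ' * t) ^ 2 -
        3 / (2 * (δ * t)) * ((2 - δ) * t) =
          3 / 8 * Real.sinh (3 / 2) * p - (25 / 6 * p - 3 / 2) := by
      have h1 : D ^ 2 * (3 / (2 * (δ * t)) * Real.sinh (3 / 2) / (δ * t)) * (δ' * t) ^ 2 =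
          3 / 8 * Real.sinh (3 / 2) * p := by
        rw [hδ, hδ']
        field_simp
        rw [Real.sq_sqrt hp0.le]
        ring
      have h2 : 3 / (2 * (δ * t)) * ((2 - δ) * t) = 25 / 6 * p - 3 / 2 := by
        rw [hδ]
        field_simp
        ring
      rw [h1, h2]
    rwa [e1, e2] at h
  have key := lintegral_rpow_le_of_meas_lt_le hFm.aemeasurable hGm.aemeasurable hSm.aemeasurable
    (hae F hFm hIF) (hae G hGm hIG) (hae S hSm hIS) hp0 three_pos hδ0 hδ0' good
  have h := rpow_le_of_absorb hp hIF (by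
    rw [ENNReal.ofReal_rpow_of_pos three_pos, ← ENNReal.ofReal_mul (by positivity)]
    exact ENNReal.ofReal_le_ofReal (three_rpow_mul_exp_le hp)) key
  rw [hnorm, hnorm, hnorm]
  refine h.trans_eq ?_
  rw [mul_add, ← mul_assoc, ← mul_assoc, ← ENNReal.ofReal_mul (by norm_num),
    ← ENNReal.ofReal_mul (by norm_num), ← ENNReal.ofReal_mul (by norm_num)]
  congr 3
  · rw [hδ]
    field_simp
    norm_num
  · rw [hδ']
    field_simp
    norm_num

end Transfer

end BurkholderRosenthal

theorem theorem3p1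
    {X : Type*} [NormedAddCommGroup X] [NormedSpace ℝ X] [CompleteSpace X]
    {D : ℝ} (hX : BurkholderRosenthal.IsTwoSmooth X D)
    {Ω : Type*} {m0 : MeasurableSpace Ω} {μ : Measure Ω} [IsProbabilityMeasure μ]
    {k : ℕ} (ℱ : Filtration (Fin (k + 1)) m0)
    (f g : Fin (k + 1) → Ω → X) (V : Fin k → Ω → X →L[ℝ] X)
    (hf : StronglyAdapted ℱ f) (hg : Martingale g ℱ μ)
    (hV : BurkholderRosenthal.IsPredictableContraction ℱ V)
    (hf0 : ∀ᵐ ω ∂μ, f 0 ω = 0) (hg0 : ∀ᵐ ω ∂μ, g 0 ω = 0)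
    (hrec : ∀ j : Fin k, ∀ᵐ ω ∂μ,
      f j.succ ω = V j ω (f j.castSucc ω) + BurkholderRosenthal.diffSeq g j ω)
    {p : ℝ} (hp : 2 ≤ p) :
    eLpNorm (BurkholderRosenthal.maximalFunction f) (ENNReal.ofReal p) μ
        ≤ ENNReal.ofReal (30 * p)
            * eLpNorm (BurkholderRosenthal.maximalFunction (BurkholderRosenthal.diffSeq g))
                (ENNReal.ofReal p) μ
          + ENNReal.ofReal (40 * D * √p)
            * eLpNorm (BurkholderRosenthal.condSquareFunction ℱ μ g) (ENNReal.ofReal p) μ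
    ∧ (BurkholderRosenthal.HasCondSymmIncrements ℱ μ g →
      eLpNorm (BurkholderRosenthal.maximalFunction f) (ENNReal.ofReal p) μ
        ≤ ENNReal.ofReal (5 * p)
            * eLpNorm (BurkholderRosenthal.maximalFunction (BurkholderRosenthal.diffSeq g))
                (ENNReal.ofReal p) μ
          + ENNReal.ofReal (10 * D * √p)
            * eLpNorm (BurkholderRosenthal.condSquareFunction ℱ μ g) (ENNReal.ofReal p) μ) := by
  have key := hX.eLpNorm_maximalFunction_le ℱ f g V hf hg hV hf0 hrec hp
  have hD : 0 ≤ D := zero_le_one.trans hX.1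
  refine ⟨key.trans ?_, fun _ => key⟩
  gcongr <;> norm_num
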